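/- Let $(R,\mathfrak m)$ be a Noetherian local ring. Then the following statements are equivalent. (i) $R$ is catenary, i.e. for all prime ideals $\mathfrak p\subseteq\mathfrak q$ of $R$, the lengths of chains of prime ideals from $\mathfrak p$ to $\mathfrak q$ are bounded and all saturated such chains have the same length. (ii) For every finitely generated $R$-module $M$ and every prime ideal $\mathfrak p$ of $R$, $$\operatorname{Ann}_{R_{\mathfrak p}} H^{\dim_R M-\dim(R/\mathfrak p)}_{\mathfrak pR_{\mathfrak p}}(M_{\mathfrak p})=\bigl(\operatorname{Ann}_R H^{\dim_R M}_{\mathfrak m}(M)\bigr)R_{\mathfrak p}.$$ Here $H^i_I(N)=\varinjlim_t \operatorname{Ext}^i(A/I^t,N)$ is the $i$-th local cohomology module of a module $N$ over a ring $A$ with support in an ideal $I$ of $A$, with $H^i_I(N)=0$ for $i<0$. The dimension of a module is the Krull dimension of its support, with $\dim 0=-1$. -/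

import Mathlib

universe u

/-- A commutative ring is catenary if for all primes `p ⊆ q` the lengths of the chains of primes
from `p` to `q` are bounded and all saturated chains of primes from `p` to `q` (those in which
consecutive members have no prime strictly between them) have the same length `n`. A longest
chain is saturated, so `n` itself is the least bound, and a saturated chain exists. -/
def IsCatenaryRing (R : Type u) [CommRing R] : Prop :=
  ∀ p q : PrimeSpectrum R, p ≤ q → ∃ n : ℕ,
    (∀ s : LTSeries (PrimeSpectrum R), s.head = p → s.last = q → s.length ≤ n) ∧
    (∀ s : RelSeries {(a, b) : PrimeSpectrum R × PrimeSpectrum R | a ⋖ b},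
      s.head = p → s.last = q → s.length = n)

/-- A Krull dimension as an integer, with the convention `dim 0 = -1`. The value at `⊤` plays no
role for finitely generated modules over a Noetherian local ring, whose dimension is finite. -/
noncomputable def krullDimToInt (x : WithBot ℕ∞) : ℤ :=
  WithBot.recBotCoe (-1) (fun n : ℕ∞ => (n.toNat : ℤ)) x

/-- The dimension `dim_R M` of a module (the Krull dimension of its support), as an integer. -/
noncomputable def moduleDim (R : Type u) [CommRing R] (M : Type u) [AddCommGroup M] [Module R M] :
    ℤ :=
  krullDimToInt (Module.supportDim R M)

/-- The local cohomology module `H^i_I(M)` for `i : ℤ`; it is the zero module for `i < 0`. -/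
noncomputable def localCohomologyInt {R : Type u} [CommRing R] (I : Ideal R) (i : ℤ)
    (M : Type u) [AddCommGroup M] [Module R M] : ModuleCat.{u} R :=
  match i with
  | Int.ofNat n => (localCohomology I n).obj (ModuleCat.of R M)
  | Int.negSucc _ => ModuleCat.of R PUnit.{u + 1}

/-! The bridge from local cohomology to prime ideals is `mem_annihilator_locCoh_iff`: for `d ≥ dim
M`, an element `r` kills `H^d_m(M)` exactly when `dim rM < d`. If `dim rM < d`, multiplication by
`r` on `H^d_m(M)` factors through `H^d_m(rM)`, which is zero by Grothendieck vanishing. The other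
implication needs an invariant of `H^d` that detects dimension `d`. This is `koszulMult`, the
alternating sum of lengths of Koszul homology on a parameter list of length `d`. On Artinian modules
it is additive and nonnegative; it vanishes on `H^i_m` for `i < d`, is additive in `M` on
`H^d_m(M)`, and is positive there if `dim M = d`. If `r` kills `H^d_m(M)`, then `H^d_m(M) ≅
H^d_m(M/rM)`, so `H^d_m(rM)` has multiplicity zero and `dim rM < d`.

Now let `d = dim M`, `t = dim R/p` and `i = d - t ≥ 0`. A fraction `a/v` lies in the left-hand ideal
iff no chain of length `i` inside `p` starts in `Supp aM`. It lies in the right-hand ideal iff `dim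
uaM < d` for some `u ∉ p`, that is, iff no prime `q ⊆ p` in `Supp aM` has `dim R/q ≥ d`. The second
condition gives the first by concatenating chains; the first gives the second once `dim R/q ≤ ht p/q
+ dim R/p`. For a Noetherian local ring this inequality for all `q ⊆ p` is equivalent to catenarity.
Conversely, (ii) for `M = R/q` yields the inequality: the right-hand ideal is proper, so a top local
cohomology module of `(R/q)_p` is nonzero, which forces a long enough chain from `q` to `p`. -/

section ExtComparison

/-! ### Derived-functor `Ext` and `Abelian.Ext`: the same cocycles modulo the same coboundaries. -/

open CategoryTheory Opposite Limits Abelian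

variable {R : Type u} [CommRing R]

/-- The linear equivalence between the targets of two surjective linear maps with the same kernel. -/
noncomputable def equivOfKerEq {Z A B : Type*} [AddCommGroup Z] [AddCommGroup A] [AddCommGroup B]
    [Module R Z] [Module R A] [Module R B] (a : Z →ₗ[R] A) (b : Z →ₗ[R] B)
    (ha : Function.Surjective a) (hb : Function.Surjective b) (h : LinearMap.ker a = LinearMap.ker b) :
    A ≃ₗ[R] B :=
  (a.quotKerEquivOfSurjective ha).symm ≪≫ₗ Submodule.quotEquivOfEq _ _ h ≪≫ₗ
    b.quotKerEquivOfSurjective hb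

lemma equivOfKerEq_apply {Z A B : Type*} [AddCommGroup Z] [AddCommGroup A] [AddCommGroup B]
    [Module R Z] [Module R A] [Module R B] (a : Z →ₗ[R] A) (b : Z →ₗ[R] B)
    (ha : Function.Surjective a) (hb : Function.Surjective b) (h : LinearMap.ker a = LinearMap.ker b)
    (z : Z) : equivOfKerEq a b ha hb h (a z) = b z := by
  have : (a.quotKerEquivOfSurjective ha).symm (a z) = Submodule.Quotient.mk z := by
    rw [LinearEquiv.symm_apply_eq]; rfl
  simp only [equivOfKerEq, LinearEquiv.trans_apply, this]
  rfl

namespace CategoryTheory.ProjectiveResolution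

variable {X : ModuleCat.{u} R} (P : ProjectiveResolution X) (Y : ModuleCat.{u} R) (n : ℕ)

/-- The `n`-cocycles of the complex of homomorphisms from a projective resolution to `Y`. -/
noncomputable def homCocycles : Submodule R (P.complex.X n ⟶ Y) :=
  LinearMap.ker (Linear.leftComp R Y (P.complex.d (n + 1) n))

variable {Y n} in
lemma mem_homCocycles {f : P.complex.X n ⟶ Y} :
    f ∈ P.homCocycles Y n ↔ P.complex.d (n + 1) n ≫ f = 0 := Iff.rfl

variable {Y n} in
lemma homCocycles_comp (f : P.homCocycles Y n) : P.complex.d (n + 1) n ≫ f.1 = 0 := f.2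

/-- The class of a cocycle in `Abelian.Ext`. -/
noncomputable def cocycleToExt : P.homCocycles Y n →ₗ[R] Abelian.Ext X Y n where
  toFun f := P.extMk f.1 (n + 1) rfl (P.homCocycles_comp f)
  map_add' f g := (P.add_extMk _ _ _ _ _ _).symm
  map_smul' r f := by
    rw [RingHom.id_apply, Ext.smul_eq_comp_mk₀, P.extMk_comp_mk₀]
    simp

lemma cocycleToExt_surjective : Function.Surjective (P.cocycleToExt Y n) := fun α ↦ by
  obtain ⟨f, hf, rfl⟩ := P.extMk_surjective α (n + 1) rfl
  exact ⟨⟨f, P.mem_homCocycles.2 hf⟩, rfl⟩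

lemma cocycleToExt_succ_eq_zero_iff (f : P.homCocycles Y (n + 1)) :
    P.cocycleToExt Y (n + 1) f = 0 ↔ ∃ g : P.complex.X n ⟶ Y, P.complex.d (n + 1) n ≫ g = f.1 :=
  P.extMk_eq_zero_iff _ (n + 1 + 1) rfl (P.homCocycles_comp f) n rfl

lemma cocycleToExt_zero_eq_zero_iff (f : P.homCocycles Y 0) :
    P.cocycleToExt Y 0 f = 0 ↔ f = 0 := by
  refine ⟨fun h ↦ ?_, fun h ↦ by rw [h, map_zero]⟩
  change P.extMk f.1 1 rfl (P.homCocycles_comp f) = 0 at h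
  simp only [← P.extEquivCohomologyClass.apply_eq_iff_eq,
    extEquivCohomologyClass_extMk, extEquivCohomologyClass_zero,
    CochainComplex.HomComplex.CohomologyClass.mk_eq_zero_iff] at h
  rw [CochainComplex.HomComplex.Cocycle.toSingleMk_mem_coboundaries_iff _ _ _ _ _ 1 (by simp)] at h
  obtain ⟨g, hg⟩ := h
  rw [Subtype.ext_iff]
  -- In degree 0 a coboundary would come from cohomological degree 1, where the resolution is zero.
  have hz : IsZero (P.cochainComplex.X 1) :=
    CochainComplex.isZero_of_isStrictlyLE _ 0 _ (by decide)
  rw [hz.eq_zero_of_src g, comp_zero] at hg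
  exact (cancel_epi (P.cochainComplexXIso (-0) 0 rfl).hom).1 (by simpa using hg.symm)

/-- The functor whose left derived functors define `Ext (-) Y`. -/
noncomputable abbrev homFunctor : ModuleCat.{u} R ⥤ (ModuleCat.{u} R)ᵒᵖ :=
  ((linearYoneda R (ModuleCat.{u} R)).obj Y).rightOp

/-- The opposite of the complex of homomorphisms from a projective resolution to `Y`. -/
noncomputable abbrev homComplexOp : ChainComplex (ModuleCat.{u} R)ᵒᵖ ℕ :=
  ((homFunctor Y).mapHomologicalComplex _).obj P.complex

lemma pOpcycles_unop_exact : Function.Exact ((P.homComplexOp Y).pOpcycles n).unop.hom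
    ((P.homComplexOp Y).d (n + 1) n).unop.hom := by
  have h := ShortComplex.exact_of_g_is_cokernel
    (ShortComplex.mk _ _ ((P.homComplexOp Y).d_pOpcycles (n + 1) n))
    ((P.homComplexOp Y).opcyclesIsCokernel (n + 1) n (by simp))
  exact (ShortComplex.ShortExact.moduleCat_exact_iff_function_exact _).1 h.unop

lemma pOpcycles_unop_injective :
    Function.Injective ((P.homComplexOp Y).pOpcycles n).unop.hom :=
  (ModuleCat.mono_iff_injective _).1 inferInstance

/-- The opcycles of the opposite Hom complex are the cocycles of the Hom complex. -/
noncomputable def opcyclesEquiv :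
    (unop ((P.homComplexOp Y).opcycles n) : ModuleCat.{u} R) ≃ₗ[R] P.homCocycles Y n :=
  (LinearEquiv.ofInjective ((P.homComplexOp Y).pOpcycles n).unop.hom
    (P.pOpcycles_unop_injective Y n)) ≪≫ₗ LinearEquiv.ofEq _ _ (by
      ext f
      exact (P.pOpcycles_unop_exact Y n f).symm)

lemma opcyclesEquiv_apply (c : (unop ((P.homComplexOp Y).opcycles n) : ModuleCat.{u} R)) :
    (P.opcyclesEquiv Y n c).1 = ((P.homComplexOp Y).pOpcycles n).unop.hom c := rfl

/-- The class of a cocycle in the derived functor `Ext`. -/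
noncomputable def cocycleToDerived : P.homCocycles Y n →ₗ[R]
    (unop (((homFunctor Y).leftDerived n).obj X) : ModuleCat.{u} R) :=
  (P.isoLeftDerivedObj (homFunctor Y) n).hom.unop.hom ∘ₗ
    ((P.homComplexOp Y).homologyι n).unop.hom ∘ₗ (P.opcyclesEquiv Y n).symm.toLinearMap

lemma isoLeftDerived_unop_bijective :
    Function.Bijective (P.isoLeftDerivedObj (homFunctor Y) n).hom.unop.hom :=
  ConcreteCategory.bijective_of_isIso (P.isoLeftDerivedObj (homFunctor Y) n).hom.unop

lemma cocycleToDerived_surjective : Function.Surjective (P.cocycleToDerived Y n) := by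
  have h : Function.Surjective ((P.homComplexOp Y).homologyι n).unop.hom :=
    (ModuleCat.epi_iff_surjective _).1 inferInstance
  exact (P.isoLeftDerived_unop_bijective Y n).2.comp (h.comp (P.opcyclesEquiv Y n).symm.surjective)

lemma cocycleToDerived_zero_eq_zero_iff (f : P.homCocycles Y 0) :
    P.cocycleToDerived Y 0 f = 0 ↔ f = 0 := by
  refine ⟨fun h ↦ ?_, fun h ↦ by rw [h, map_zero]⟩
  have h1 := (P.isoLeftDerived_unop_bijective Y 0).1 (h.trans (map_zero _).symm)
  have h2 : Function.Injective ((P.homComplexOp Y).homologyι 0).unop.hom :=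
    (ConcreteCategory.bijective_of_isIso ((P.homComplexOp Y).homologyι 0).unop).1
  have h3 := h2 (h1.trans (map_zero _).symm)
  exact (LinearEquiv.map_eq_zero_iff _).1 h3

lemma cocycleToDerived_succ_eq_zero_iff (f : P.homCocycles Y (n + 1)) :
    P.cocycleToDerived Y (n + 1) f = 0 ↔
      ∃ g : P.complex.X n ⟶ Y, P.complex.d (n + 1) n ≫ g = f.1 := by
  have hex : Function.Exact ((P.homComplexOp Y).fromOpcycles (n + 1) n).unop.hom
      ((P.homComplexOp Y).homologyι (n + 1)).unop.hom := by
    have h := ShortComplex.exact_of_f_is_kernel (ShortComplex.mk _ _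
      ((P.homComplexOp Y).homologyι_comp_fromOpcycles (n + 1) n))
      ((P.homComplexOp Y).homologyIsKernel (n + 1) n (by simp))
    exact (ShortComplex.ShortExact.moduleCat_exact_iff_function_exact _).1 h.unop
  have h1 : P.cocycleToDerived Y (n + 1) f = 0 ↔
      ((P.homComplexOp Y).homologyι (n + 1)).unop.hom ((P.opcyclesEquiv Y (n + 1)).symm f) = 0 :=
    ⟨fun h ↦ (P.isoLeftDerived_unop_bijective Y _).1 (h.trans (map_zero _).symm),
      fun h ↦ (congrArg (P.isoLeftDerivedObj (homFunctor Y) (n + 1)).hom.unop.hom h).trans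
        (map_zero _)⟩
  rw [h1, hex]
  refine exists_congr fun g ↦ ?_
  rw [LinearEquiv.eq_symm_apply, Subtype.ext_iff, opcyclesEquiv_apply]
  have h2 := (P.homComplexOp Y).p_fromOpcycles (n + 1) n
  have h3 := congrArg (fun k ↦ k.unop.hom g) h2
  exact Eq.congr_left h3

lemma ker_cocycleToDerived :
    LinearMap.ker (P.cocycleToDerived Y n) = LinearMap.ker (P.cocycleToExt Y n) := by
  ext f
  rw [LinearMap.mem_ker, LinearMap.mem_ker]
  cases n with
  | zero => rw [cocycleToDerived_zero_eq_zero_iff, cocycleToExt_zero_eq_zero_iff]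
  | succ n => rw [cocycleToDerived_succ_eq_zero_iff, cocycleToExt_succ_eq_zero_iff]

/-- Postcomposition of cocycles. -/
noncomputable def homCocyclesPostcomp {Y Y' : ModuleCat.{u} R} (g : Y ⟶ Y')
    (f : P.homCocycles Y n) : P.homCocycles Y' n :=
  ⟨f.1 ≫ g, P.mem_homCocycles.2 (by rw [← Category.assoc, P.homCocycles_comp, zero_comp])⟩

lemma cocycleToExt_postcomp {Y Y' : ModuleCat.{u} R} (g : Y ⟶ Y') (f : P.homCocycles Y n) :
    P.cocycleToExt Y' n (P.homCocyclesPostcomp n g f) =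
      (P.cocycleToExt Y n f).comp (Abelian.Ext.mk₀ g) (add_zero n) :=
  (P.extMk_comp_mk₀ _ _ rfl (P.homCocycles_comp f) g).symm

/-- Serves naturality in both variables. The Hom complexes live in the opposite category, so the
induced map on cocycles runs from `P'` back to `P`. -/
lemma homologyMap_unop_apply {X' Y' : ModuleCat.{u} R} (P' : ProjectiveResolution X')
    (ψ : P.homComplexOp Y ⟶ P'.homComplexOp Y') (f' : P'.homCocycles Y' n)
    (f : P.homCocycles Y n) (hf : (ψ.f n).unop.hom f'.1 = f.1) :
    (HomologicalComplex.homologyMap ψ n).unop.hom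
      (((P'.homComplexOp Y').homologyι n).unop.hom ((P'.opcyclesEquiv Y' n).symm f')) =
    ((P.homComplexOp Y).homologyι n).unop.hom ((P.opcyclesEquiv Y n).symm f) := by
  have h1 := congrArg (fun k ↦ k.unop.hom ((P'.opcyclesEquiv Y' n).symm f'))
    (HomologicalComplex.homologyι_naturality ψ n)
  have h2 := congrArg (fun k ↦ k.unop.hom ((P'.opcyclesEquiv Y' n).symm f'))
    (HomologicalComplex.p_opcyclesMap ψ n)
  refine h1.trans (congrArg ((P.homComplexOp Y).homologyι n).unop.hom ?_)
  rw [LinearEquiv.eq_symm_apply, Subtype.ext_iff, opcyclesEquiv_apply]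
  refine Eq.trans h2 (Eq.trans (congrArg (ψ.f n).unop.hom ?_) hf)
  exact congrArg Subtype.val ((P'.opcyclesEquiv Y' n).apply_symm_apply f')

lemma isoLeftDerived_inv_unop_cocycleToDerived (f : P.homCocycles Y n) :
    (P.isoLeftDerivedObj (homFunctor Y) n).inv.unop.hom (P.cocycleToDerived Y n f) =
      ((P.homComplexOp Y).homologyι n).unop.hom ((P.opcyclesEquiv Y n).symm f) :=
  congrArg (fun k ↦ k.unop.hom (((P.homComplexOp Y).homologyι n).unop.hom
    ((P.opcyclesEquiv Y n).symm f))) (P.isoLeftDerivedObj (homFunctor Y) n).inv_hom_id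

lemma cocycleToDerived_postcomp {Y Y' : ModuleCat.{u} R} (g : Y ⟶ Y') (f : P.homCocycles Y n) :
    ((NatTrans.leftDerived (NatTrans.rightOp ((linearYoneda R (ModuleCat.{u} R)).map g)) n).app
      X).unop.hom (P.cocycleToDerived Y n f) =
      P.cocycleToDerived Y' n (P.homCocyclesPostcomp n g f) := by
  have h := congrArg (fun k ↦ k.unop.hom (P.cocycleToDerived Y n f))
    (leftDerived_app_eq (NatTrans.rightOp ((linearYoneda R (ModuleCat.{u} R)).map g)) P n)
  refine h.trans (congrArg (P.isoLeftDerivedObj (homFunctor Y') n).hom.unop.hom ?_)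
  refine Eq.trans (congrArg (HomologicalComplex.homologyMap ((NatTrans.mapHomologicalComplex
    (NatTrans.rightOp ((linearYoneda R (ModuleCat.{u} R)).map g)) _).app P.complex) n).unop.hom
    (P.isoLeftDerived_inv_unop_cocycleToDerived Y n f)) ?_
  exact P.homologyMap_unop_apply Y' n P _ f (P.homCocyclesPostcomp n g f) rfl

/-- Precomposition of cocycles with a morphism of resolutions. -/
noncomputable def homCocyclesPrecomp {X' : ModuleCat.{u} R} {P' : ProjectiveResolution X'}
    (φ : P'.complex ⟶ P.complex) (f : P.homCocycles Y n) : P'.homCocycles Y n :=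
  ⟨φ.f n ≫ f.1, P'.mem_homCocycles.2 (by
    rw [← φ.comm_assoc, P.homCocycles_comp, comp_zero])⟩

lemma cocycleToExt_precomp {X' : ModuleCat.{u} R} {P' : ProjectiveResolution X'}
    {g : X' ⟶ X} (φ : Hom P' P g) (f : P.homCocycles Y n) :
    P'.cocycleToExt Y n (P.homCocyclesPrecomp Y n φ.hom f) =
      (Abelian.Ext.mk₀ g).comp (P.cocycleToExt Y n f) (zero_add n) :=
  (mk₀_comp_extMk _ _ rfl (P.homCocycles_comp f) φ).symm

lemma cocycleToDerived_precomp {X' : ModuleCat.{u} R} {P' : ProjectiveResolution X'}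
    {g : X' ⟶ X} (φ : Hom P' P g) (f : P.homCocycles Y n) :
    (((homFunctor Y).leftDerived n).map g).unop.hom (P.cocycleToDerived Y n f) =
      P'.cocycleToDerived Y n (P.homCocyclesPrecomp Y n φ.hom f) := by
  have w : φ.hom ≫ P.π = P'.π ≫ (ChainComplex.single₀ (ModuleCat.{u} R)).map g := by
    ext1
    exact φ.hom_f_zero_comp_π_f_zero
  have h := congrArg (fun k ↦ k.unop.hom (P.cocycleToDerived Y n f))
    (Functor.leftDerived_map_eq (homFunctor Y) n g φ.hom w)
  refine h.trans (congrArg (P'.isoLeftDerivedObj (homFunctor Y) n).hom.unop.hom ?_)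
  refine Eq.trans (congrArg (HomologicalComplex.homologyMap
    (((homFunctor Y).mapHomologicalComplex _).map φ.hom) n).unop.hom
    (P.isoLeftDerived_inv_unop_cocycleToDerived Y n f)) ?_
  exact P'.homologyMap_unop_apply Y n P _ f (P.homCocyclesPrecomp Y n φ.hom f) rfl

end CategoryTheory.ProjectiveResolution

/-- `Ext` as a derived functor agrees with `Abelian.Ext`. -/
noncomputable def derivedExtEquiv (X Y : ModuleCat.{u} R) (n : ℕ) :
    ((_root_.Ext R (ModuleCat.{u} R) n).obj (op X)).obj Y ≃ₗ[R] Abelian.Ext X Y n :=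
  equivOfKerEq ((projectiveResolution X).cocycleToDerived Y n)
    ((projectiveResolution X).cocycleToExt Y n)
    ((projectiveResolution X).cocycleToDerived_surjective Y n)
    ((projectiveResolution X).cocycleToExt_surjective Y n)
    ((projectiveResolution X).ker_cocycleToDerived Y n)

lemma derivedExtEquiv_cocycleToDerived (X Y : ModuleCat.{u} R) (n : ℕ)
    (f : (projectiveResolution X).homCocycles Y n) :
    derivedExtEquiv X Y n ((projectiveResolution X).cocycleToDerived Y n f) =
      (projectiveResolution X).cocycleToExt Y n f :=
  equivOfKerEq_apply _ _ _ _ _ f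

lemma derivedExtEquiv_map (X : ModuleCat.{u} R) {Y Y' : ModuleCat.{u} R} (g : Y ⟶ Y') (n : ℕ)
    (e : ((_root_.Ext R (ModuleCat.{u} R) n).obj (op X)).obj Y) :
    derivedExtEquiv X Y' n (((_root_.Ext R (ModuleCat.{u} R) n).obj (op X)).map g e) =
      (derivedExtEquiv X Y n e).comp (Abelian.Ext.mk₀ g) (add_zero n) := by
  obtain ⟨f, rfl⟩ := (projectiveResolution X).cocycleToDerived_surjective Y n e
  rw [derivedExtEquiv_cocycleToDerived, ← ProjectiveResolution.cocycleToExt_postcomp,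
    ← derivedExtEquiv_cocycleToDerived, ← ProjectiveResolution.cocycleToDerived_postcomp]
  rfl

lemma derivedExtEquiv_map_app {X X' : ModuleCat.{u} R} (g : X' ⟶ X) (Y : ModuleCat.{u} R) (n : ℕ)
    (e : ((_root_.Ext R (ModuleCat.{u} R) n).obj (op X)).obj Y) :
    derivedExtEquiv X' Y n (((_root_.Ext R (ModuleCat.{u} R) n).map g.op).app Y e) =
      (Abelian.Ext.mk₀ g).comp (derivedExtEquiv X Y n e) (zero_add n) := by
  obtain ⟨f, rfl⟩ := (projectiveResolution X).cocycleToDerived_surjective Y n e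
  let φ : ProjectiveResolution.Hom (projectiveResolution X') (projectiveResolution X) g :=
    { hom := ProjectiveResolution.lift g _ _
      hom_f_zero_comp_π_f_zero := HomologicalComplex.congr_hom
        (ProjectiveResolution.lift_commutes g _ _) 0 }
  rw [derivedExtEquiv_cocycleToDerived, ← ProjectiveResolution.cocycleToExt_precomp _ _ _ φ,
    ← derivedExtEquiv_cocycleToDerived, ← ProjectiveResolution.cocycleToDerived_precomp]
  rfl

end ExtComparison

/-! ### Local cohomology as a concrete direct limit of `Abelian.Ext` modules. -/

section LocalCohomology

open CategoryTheory Opposite Limits Abelian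

variable {R : Type u} [CommRing R] (I : Ideal R) (i : ℕ)

lemma map_derivedExtEquiv_symm (X : ModuleCat.{u} R) {Y Y' : ModuleCat.{u} R} (g : Y ⟶ Y') (n : ℕ)
    (e : Abelian.Ext X Y n) :
    ((_root_.Ext R (ModuleCat.{u} R) n).obj (op X)).map g ((derivedExtEquiv X Y n).symm e) =
      (derivedExtEquiv X Y' n).symm (e.comp (Abelian.Ext.mk₀ g) (add_zero n)) := by
  rw [LinearEquiv.eq_symm_apply, derivedExtEquiv_map, LinearEquiv.apply_symm_apply]

lemma map_app_derivedExtEquiv_symm {X X' : ModuleCat.{u} R} (g : X' ⟶ X) (Y : ModuleCat.{u} R)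
    (n : ℕ) (e : Abelian.Ext X Y n) :
    ((_root_.Ext R (ModuleCat.{u} R) n).map g.op).app Y ((derivedExtEquiv X Y n).symm e) =
      (derivedExtEquiv X' Y n).symm ((Abelian.Ext.mk₀ g).comp e (zero_add n)) := by
  rw [LinearEquiv.eq_symm_apply, derivedExtEquiv_map_app, LinearEquiv.apply_symm_apply]

/-- The module `R ⧸ I ^ t`. -/
abbrev powQuot (t : ℕ) : ModuleCat.{u} R := ModuleCat.of R (R ⧸ I ^ t)

/-- The projection `R ⧸ I ^ t → R ⧸ I ^ s` for `s ≤ t`. -/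
def powQuotMap {s t : ℕ} (h : s ≤ t) : powQuot I t ⟶ powQuot I s :=
  ModuleCat.ofHom (Submodule.mapQ _ _ LinearMap.id (Ideal.pow_le_pow_right h))

/-- The class in local cohomology of an element of `Ext^i(R ⧸ I ^ t, M)`. -/
noncomputable def ofExt (M : ModuleCat.{u} R) (t : ℕ) :
    Abelian.Ext (powQuot I t) M i →ₗ[R] (localCohomology I i).obj M :=
  ((colimit.ι (localCohomology.diagram (localCohomology.idealPowersDiagram I) i)
    (op (op t))).app M).hom ∘ₗ (derivedExtEquiv (powQuot I t) M i).symm.toLinearMap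

/-- The cocone presenting local cohomology of a fixed module as a colimit. -/
noncomputable def localCohomologyCocone (M : ModuleCat.{u} R) :
    Cocone (localCohomology.diagram (localCohomology.idealPowersDiagram I) i ⋙
      (evaluation _ _).obj M) :=
  ((evaluation _ _).obj M).mapCocone
    (colimit.cocone (localCohomology.diagram (localCohomology.idealPowersDiagram I) i))

/-- Local cohomology of a fixed module is a colimit. -/
noncomputable def localCohomologyIsColimit (M : ModuleCat.{u} R) :
    IsColimit (localCohomologyCocone I i M) :=
  isColimitOfPreserves ((evaluation _ _).obj M) (colimit.isColimit _)

variable {I i}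

/-- The powers of `I` are indexed by `ℕ`, a category in universe 0, while the modules live in
universe `u`. -/
instance : PreservesFilteredColimitsOfSize.{0, 0} (forget (ModuleCat.{u} R)) :=
  preservesFilteredColimitsOfSize_shrink.{0, u, 0, u} _

/-- Together with `ofExt_precomp` and `exists_precomp_eq_zero` this reduces arguments on local
cohomology to representatives in `Ext`. -/
lemma ofExt_surjective {M : ModuleCat.{u} R} (x : (localCohomology I i).obj M) :
    ∃ (t : ℕ) (e : Abelian.Ext (powQuot I t) M i), ofExt I i M t e = x := by
  obtain ⟨j, y, hy⟩ := Concrete.isColimit_exists_rep _ (localCohomologyIsColimit I i M) x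
  refine ⟨j.unop.unop, derivedExtEquiv _ _ _ y, ?_⟩
  refine Eq.trans ?_ hy
  change ((colimit.ι (localCohomology.diagram (localCohomology.idealPowersDiagram I) i)
    j).app M).hom ((derivedExtEquiv _ _ _).symm (derivedExtEquiv _ _ _ y)) = _
  exact congrArg ((colimit.ι (localCohomology.diagram (localCohomology.idealPowersDiagram I) i)
    j).app M).hom (LinearEquiv.symm_apply_apply _ y)

lemma diagram_map_app {M : ModuleCat.{u} R} {s t : ℕ} (h : s ≤ t)
    (e : Abelian.Ext (powQuot I s) M i) :
    ((localCohomology.diagram (localCohomology.idealPowersDiagram I) i).map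
      (homOfLE h).op.op).app M ((derivedExtEquiv _ _ _).symm e) =
    (derivedExtEquiv _ _ _).symm ((Ext.mk₀ (powQuotMap I h)).comp e (zero_add i)) :=
  map_app_derivedExtEquiv_symm (powQuotMap I h) M i e

lemma ofExt_precomp {M : ModuleCat.{u} R} {s t : ℕ} (h : s ≤ t)
    (e : Abelian.Ext (powQuot I s) M i) :
    ofExt I i M t ((Ext.mk₀ (powQuotMap I h)).comp e (zero_add i)) = ofExt I i M s e := by
  have h1 := congrArg (fun k ↦ (k.app M).hom ((derivedExtEquiv (powQuot I s) M i).symm e))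
    (colimit.w (localCohomology.diagram (localCohomology.idealPowersDiagram I) i)
      (homOfLE h).op.op)
  refine Eq.trans (congrArg ((colimit.ι (localCohomology.diagram
    (localCohomology.idealPowersDiagram I) i) (op (op t))).app M).hom ?_) h1
  exact (diagram_map_app h e).symm

lemma exists_precomp_eq_zero {M : ModuleCat.{u} R} {s : ℕ}
    (e : Abelian.Ext (powQuot I s) M i) (he : ofExt I i M s e = 0) :
    ∃ (t : ℕ) (h : s ≤ t), (Ext.mk₀ (powQuotMap I h)).comp e (zero_add i) = 0 := by
  obtain ⟨k, f, g, hfg⟩ := Concrete.isColimit_exists_of_rep_eq _ (localCohomologyIsColimit I i M)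
    (i := op (op s)) (j := op (op s)) ((derivedExtEquiv (powQuot I s) M i).symm e) 0
    (he.trans (map_zero _).symm)
  refine ⟨k.unop.unop, leOfHom f.unop.unop, ?_⟩
  have h1 : ((localCohomology.diagram (localCohomology.idealPowersDiagram I) i).map
      f).app M ((derivedExtEquiv _ _ _).symm e) = 0 := hfg.trans (map_zero _)
  have h2 := (diagram_map_app (leOfHom f.unop.unop) e).symm.trans h1
  exact (LinearEquiv.map_eq_zero_iff _).1 h2

lemma map_ofExt {M N : ModuleCat.{u} R} (g : M ⟶ N) {t : ℕ} (e : Abelian.Ext (powQuot I t) M i) :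
    ((localCohomology I i).map g).hom (ofExt I i M t e) =
      ofExt I i N t (e.comp (Ext.mk₀ g) (add_zero i)) := by
  have h1 := congrArg (fun k ↦ k.hom ((derivedExtEquiv (powQuot I t) M i).symm e))
    ((colimit.ι (localCohomology.diagram (localCohomology.idealPowersDiagram I) i)
      (op (op t))).naturality g)
  refine Eq.trans h1.symm (congrArg ((colimit.ι (localCohomology.diagram
    (localCohomology.idealPowersDiagram I) i) (op (op t))).app N).hom ?_)
  exact map_derivedExtEquiv_symm (powQuot I t) g i e

/-- Linear maps out of local cohomology are given by compatible families on the `Ext` modules. -/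
lemma exists_localCohomology_desc {M : ModuleCat.{u} R} {N : Type u} [AddCommGroup N] [Module R N]
    (φ : ∀ t, Abelian.Ext (powQuot I t) M i →ₗ[R] N)
    (hφ : ∀ (s t : ℕ) (h : s ≤ t) (e : Abelian.Ext (powQuot I s) M i),
      φ t ((Ext.mk₀ (powQuotMap I h)).comp e (zero_add i)) = φ s e) :
    ∃ ψ : (localCohomology I i).obj M →ₗ[R] N, ∀ t e, ψ (ofExt I i M t e) = φ t e := by
  let c : Cocone (localCohomology.diagram (localCohomology.idealPowersDiagram I) i ⋙
      (evaluation _ _).obj M) :=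
    { pt := ModuleCat.of R N
      ι := { app := fun j ↦ ModuleCat.ofHom
              (φ j.unop.unop ∘ₗ (derivedExtEquiv (powQuot I j.unop.unop) M i).toLinearMap)
             naturality := by
              intro j k f
              ext x
              obtain ⟨e, rfl⟩ := (derivedExtEquiv (powQuot I j.unop.unop) M i).symm.surjective x
              have h1 := diagram_map_app (leOfHom f.unop.unop) e
              have h2 := congrArg (φ k.unop.unop ∘ₗ
                (derivedExtEquiv (powQuot I k.unop.unop) M i).toLinearMap) h1
              refine Eq.trans h2 ?_
              refine Eq.trans (congrArg (φ k.unop.unop) (LinearEquiv.apply_symm_apply _ _)) ?_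
              refine Eq.trans (hφ _ _ _ e) ?_
              exact (congrArg (φ j.unop.unop) (LinearEquiv.apply_symm_apply _ e)).symm } }
  refine ⟨((localCohomologyIsColimit I i M).desc c).hom, fun t e ↦ ?_⟩
  have h1 := congrArg (fun k ↦ k.hom ((derivedExtEquiv (powQuot I t) M i).symm e))
    ((localCohomologyIsColimit I i M).fac c (op (op t)))
  refine Eq.trans h1 ?_
  exact congrArg (φ t) (LinearEquiv.apply_symm_apply _ e)

end LocalCohomology

/-! ### The long exact sequence of local cohomology. -/

section LocalCohomologySequence

open CategoryTheory Opposite Limits Abelian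

variable {R : Type u} [CommRing R] (I : Ideal R) (i : ℕ)

/-- The `i`-th local cohomology of an unbundled module. -/
noncomputable abbrev LocCoh (M : Type u) [AddCommGroup M] [Module R M] : ModuleCat.{u} R :=
  (localCohomology I i).obj (ModuleCat.of R M)

variable {M M' M'' : Type u} [AddCommGroup M] [Module R M] [AddCommGroup M'] [Module R M']
  [AddCommGroup M''] [Module R M'']

/-- The map induced on local cohomology by a linear map. -/
noncomputable def locCohMap (f : M →ₗ[R] M') : LocCoh I i M →ₗ[R] LocCoh I i M' :=
  ((localCohomology I i).map (ModuleCat.ofHom f)).hom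

variable {I i}

lemma locCohMap_ofExt (f : M →ₗ[R] M') {t : ℕ}
    (e : Abelian.Ext (powQuot I t) (ModuleCat.of R M) i) :
    locCohMap I i f (ofExt I i _ t e) =
      ofExt I i _ t (e.comp (Ext.mk₀ (ModuleCat.ofHom f)) (add_zero i)) :=
  map_ofExt (ModuleCat.ofHom f) e

lemma locCohMap_comp (g : M' →ₗ[R] M'') (f : M →ₗ[R] M') (x : LocCoh I i M) :
    locCohMap I i (g ∘ₗ f) x = locCohMap I i g (locCohMap I i f x) := by
  have h := congrArg (fun k ↦ k.hom x)
    ((localCohomology I i).map_comp (ModuleCat.ofHom f) (ModuleCat.ofHom g))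
  exact h

lemma locCohMap_smul_id (r : R) (x : LocCoh I i M) :
    locCohMap I i (r • (LinearMap.id : M →ₗ[R] M)) x = r • x := by
  obtain ⟨t, e, rfl⟩ := ofExt_surjective x
  rw [locCohMap_ofExt]
  have : ModuleCat.ofHom (r • (LinearMap.id : M →ₗ[R] M)) = r • 𝟙 (ModuleCat.of R M) := rfl
  rw [this, ← Ext.smul_eq_comp_mk₀, map_smul]

lemma locCohMap_zero (x : LocCoh I i M) : locCohMap I i (0 : M →ₗ[R] M') x = 0 := by
  obtain ⟨t, e, rfl⟩ := ofExt_surjective x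
  rw [locCohMap_ofExt]
  have : ModuleCat.ofHom (0 : M →ₗ[R] M') = 0 := rfl
  rw [this, Ext.mk₀_zero, Ext.comp_zero, map_zero]

/-- By linearity, `r` acts on local cohomology through the map induced by multiplication by `r` on
`M`. -/
lemma annihilator_le_annihilator_locCoh :
    Module.annihilator R M ≤ Module.annihilator R (LocCoh I i M) := fun r hr ↦ by
  rw [Module.mem_annihilator] at hr ⊢
  intro x
  rw [← locCohMap_smul_id]
  have : r • (LinearMap.id : M →ₗ[R] M) = 0 := LinearMap.ext hr
  rw [this, locCohMap_zero]

/-- A class whose product with `β` vanishes in local cohomology is represented by a class in `Ext`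
whose product with `β` vanishes. -/
lemma exists_rep_comp_eq_zero {X Y : ModuleCat.{u} R} {k j : ℕ} (β : Abelian.Ext X Y k)
    (hj : i + k = j) {t : ℕ} (e : Abelian.Ext (powQuot I t) X i)
    (h : ofExt I j Y t (e.comp β hj) = 0) :
    ∃ (s : ℕ) (e' : Abelian.Ext (powQuot I s) X i),
      ofExt I i X s e' = ofExt I i X t e ∧ e'.comp β hj = 0 := by
  obtain ⟨s, hs, h0⟩ := exists_precomp_eq_zero _ h
  refine ⟨s, (Ext.mk₀ (powQuotMap I hs)).comp e (zero_add i), ofExt_precomp hs e, ?_⟩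
  rw [Ext.comp_assoc (a₂₃ := j) _ _ _ _ hj (by lia), h0]

variable {f : M' →ₗ[R] M} {g : M →ₗ[R] M''}

lemma shortExact_ofHom (hf : Function.Injective f) (hg : Function.Surjective g)
    (hfg : Function.Exact f g) :
    (ShortComplex.mk (ModuleCat.ofHom f) (ModuleCat.ofHom g)
      (by ext x; exact hfg.apply_apply_eq_zero x)).ShortExact where
  exact := (ShortComplex.ShortExact.moduleCat_exact_iff_function_exact _).2 hfg
  mono_f := (ModuleCat.mono_iff_injective _).2 hf
  epi_g := (ModuleCat.epi_iff_surjective _).2 hg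

/-- A class that dies in the limit has a representative that dies in `Ext` itself, at a higher power
of `I`; the covariant `Ext` sequence applies to that representative. -/
lemma locCohMap_exact (hf : Function.Injective f) (hg : Function.Surjective g)
    (hfg : Function.Exact f g) : Function.Exact (locCohMap I i f) (locCohMap I i g) := by
  intro x
  constructor
  · intro hx
    obtain ⟨t, e, rfl⟩ := ofExt_surjective x
    rw [locCohMap_ofExt] at hx
    obtain ⟨s, e', h1, h2⟩ := exists_rep_comp_eq_zero _ (add_zero i) e hx
    obtain ⟨y, hy⟩ := Ext.covariant_sequence_exact₂ _ (shortExact_ofHom hf hg hfg) e' h2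
    refine ⟨ofExt I i _ s y, ?_⟩
    rw [locCohMap_ofExt, ← h1, ← hy]
  · rintro ⟨y, rfl⟩
    rw [← locCohMap_comp]
    have : g ∘ₗ f = 0 := LinearMap.ext fun x ↦ hfg.apply_apply_eq_zero x
    rw [this, locCohMap_zero]

/-- The connecting map is the product with the extension class, which commutes with restriction
along `R/I^t → R/I^s` by associativity. -/
lemma exists_locCoh_connecting (hf : Function.Injective f) (hg : Function.Surjective g)
    (hfg : Function.Exact f g) :
    ∃ δ : LocCoh I i M'' →ₗ[R] LocCoh I (i + 1) M',
      Function.Exact (locCohMap I i g) δ ∧ Function.Exact δ (locCohMap I (i + 1) f) := by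
  have hS := shortExact_ofHom hf hg hfg
  obtain ⟨δ, hδ⟩ := exists_localCohomology_desc (I := I) (i := i) (M := ModuleCat.of R M'')
    (N := LocCoh I (i + 1) M')
    (fun t ↦ ofExt I (i + 1) _ t ∘ₗ Ext.postcompOfLinear hS.extClass R (powQuot I t) rfl)
    (fun s t h e ↦ by
      have h1 : ((Ext.mk₀ (powQuotMap I h)).comp e (zero_add i)).comp hS.extClass rfl =
          (Ext.mk₀ (powQuotMap I h)).comp (e.comp hS.extClass rfl) (zero_add (i + 1)) :=
        Ext.comp_assoc _ _ _ _ _ (by lia)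
      exact (congrArg (ofExt I (i + 1) _ t) h1).trans (ofExt_precomp h _))
  have hδ' : ∀ t (e : Abelian.Ext (powQuot I t) (ModuleCat.of R M'') i),
      δ (ofExt I i _ t e) = ofExt I (i + 1) _ t (e.comp hS.extClass rfl) := hδ
  refine ⟨δ, fun x ↦ ⟨fun hx ↦ ?_, ?_⟩, fun x ↦ ⟨fun hx ↦ ?_, ?_⟩⟩
  · obtain ⟨t, e, rfl⟩ := ofExt_surjective x
    rw [hδ'] at hx
    obtain ⟨s, e', h1, h2⟩ := exists_rep_comp_eq_zero _ rfl e hx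
    obtain ⟨y, hy⟩ := Ext.covariant_sequence_exact₃ _ hS e' rfl h2
    refine ⟨ofExt I i _ s y, ?_⟩
    rw [locCohMap_ofExt, ← h1, ← hy]
  · rintro ⟨y, rfl⟩
    obtain ⟨t, e, rfl⟩ := ofExt_surjective y
    rw [locCohMap_ofExt, hδ', Ext.comp_assoc (a₂₃ := 1) _ _ _ _ (by lia) (by lia)]
    have := hS.comp_extClass
    dsimp only at this
    rw [this, Ext.comp_zero, map_zero]
  · obtain ⟨t, e, rfl⟩ := ofExt_surjective x
    rw [locCohMap_ofExt] at hx
    obtain ⟨s, e', h1, h2⟩ := exists_rep_comp_eq_zero _ (add_zero _) e hx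
    obtain ⟨y, hy⟩ := Ext.covariant_sequence_exact₁ _ hS e' h2 rfl
    refine ⟨ofExt I i _ s y, ?_⟩
    rw [hδ', ← h1, ← hy]
  · rintro ⟨y, rfl⟩
    obtain ⟨t, e, rfl⟩ := ofExt_surjective y
    rw [hδ', locCohMap_ofExt, Ext.comp_assoc (a₂₃ := 1) _ _ _ _ (by lia) (by lia)]
    have := hS.extClass_comp
    dsimp only at this
    rw [this, Ext.comp_zero, map_zero]

lemma locCohMap_zero_injective (hf : Function.Injective f) :
    Function.Injective (locCohMap I 0 f) := by
  rw [injective_iff_map_eq_zero]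
  intro x hx
  obtain ⟨t, e, rfl⟩ := ofExt_surjective x
  rw [locCohMap_ofExt] at hx
  obtain ⟨s, e', h1, h2⟩ := exists_rep_comp_eq_zero _ (add_zero _) e hx
  have : Mono (ModuleCat.ofHom f) := (ModuleCat.mono_iff_injective _).2 hf
  have h3 := Ext.postcomp_mk₀_injective_of_mono (powQuot I s) (ModuleCat.ofHom f)
    (a₁ := e') (a₂ := 0) (h2.trans (map_zero _).symm)
  rw [← h1, h3, map_zero]

lemma exists_pow_smul_locCoh_eq_zero (x : LocCoh I i M) : ∃ t, ∀ a ∈ I ^ t, a • x = 0 := by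
  obtain ⟨t, e, rfl⟩ := ofExt_surjective x
  refine ⟨t, fun a ha ↦ ?_⟩
  have h1 : a • 𝟙 (powQuot I t) = 0 := by
    refine ModuleCat.hom_ext (LinearMap.ext fun y ↦ ?_)
    obtain ⟨y, rfl⟩ := Ideal.Quotient.mk_surjective y
    exact Ideal.Quotient.eq_zero_iff_mem.2 (Ideal.mul_mem_right _ _ ha)
  have h2 : a • e = (Ext.mk₀ (a • 𝟙 (powQuot I t))).comp e (zero_add i) := by
    simp [Ext.mk₀_smul]
  rw [← map_smul, h2, h1, Ext.mk₀_zero, Ext.zero_comp, map_zero]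

end LocalCohomologySequence

/-! ### Local cohomology of modules killed by a power of the ideal. -/

section FiniteLength

open CategoryTheory Opposite Limits Abelian

variable {R : Type u} [CommRing R] {I : Ideal R}

/-- The inclusion of a submodule as a morphism. -/
abbrev inclHom {L : Type u} [AddCommGroup L] [Module R L] (N : Submodule R L) :
    ModuleCat.of R N ⟶ ModuleCat.of R L := ModuleCat.ofHom N.subtype

/-- The restriction of a product with an extension class along a morphism of short exact sequences
vanishes if the left-hand component of the morphism factors through a morphism killing the other
factor. -/
lemma mk₀_comp_extClass_comp_eq_zero {S T : ShortComplex (ModuleCat.{u} R)} (hS : S.ShortExact)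
    (hT : T.ShortExact) (φ : S ⟶ T) {N W : ModuleCat.{u} R} {i j : ℕ} (η : Abelian.Ext T.X₁ N i)
    (hj : 1 + i = j) (a : S.X₁ ⟶ W) (b : W ⟶ T.X₁) (hab : a ≫ b = φ.τ₁)
    (hb : (Ext.mk₀ b).comp η (zero_add i) = 0) :
    (Ext.mk₀ φ.τ₃).comp (hT.extClass.comp η hj) (zero_add j) = 0 := by
  rw [← Ext.comp_assoc (a₁₂ := 1) _ _ _ (by lia) (by lia) (by lia),
    ← hS.extClass_naturality hT φ, Ext.comp_assoc (a₂₃ := i) _ _ _ (by lia) (by lia) (by lia),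
    ← hab, ← Ext.mk₀_comp_mk₀, Ext.comp_assoc (a₂₃ := i) _ _ _ (by lia) (by lia) (by lia), hb,
    Ext.comp_zero, Ext.comp_zero]

lemma smul_top_eq_comap (K : Type*) [AddCommGroup K] [Module R K] (J : Ideal R)
    (L : Submodule R K) (x : L) (hx : (x : K) ∈ J • L) : x ∈ J • (⊤ : Submodule R L) := by
  have h : Submodule.map L.subtype (J • ⊤) = J • L := by
    rw [Submodule.map_smul'', Submodule.map_top, Submodule.range_subtype]
  rw [← h] at hx
  obtain ⟨y, hy, hyx⟩ := hx
  rwa [← Subtype.ext hyx]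

/-- Classes of extensions of a finite module by a module killed by a power of `I` vanish after
restriction to `I ^ t • L` for large `t`. -/
lemma exists_restrict_ext_eq_zero [IsNoetherianRing R] {N : Type u} [AddCommGroup N] [Module R N]
    {n : ℕ} (hN : ∀ a ∈ I ^ n, ∀ x : N, a • x = 0) (i : ℕ) (L : Type u) [AddCommGroup L]
    [Module R L] [Module.Finite R L] (ξ : Abelian.Ext (ModuleCat.of R L) (ModuleCat.of R N) i) :
    ∃ t, (Ext.mk₀ (inclHom (I ^ t • ⊤ : Submodule R L))).comp ξ (zero_add i) = 0 := by
  induction i generalizing L with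
  | zero =>
    refine ⟨n, ?_⟩
    obtain ⟨h, rfl⟩ := (Ext.linearEquiv₀ (R := R)).symm.surjective ξ
    rw [Ext.linearEquiv₀_symm_apply, Ext.mk₀_comp_mk₀]
    have : inclHom (I ^ n • ⊤ : Submodule R L) ≫ h = 0 := by
      refine ModuleCat.hom_ext (LinearMap.ext fun ⟨y, hy⟩ ↦ ?_)
      change h.hom y = 0
      refine Submodule.smul_induction_on hy (fun r hr z _ ↦ ?_) (fun y z hy hz ↦ ?_)
      · rw [map_smul]; exact hN r hr _
      · rw [map_add, hy, hz, add_zero]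
    rw [this, Ext.mk₀_zero]
  | succ i ih =>
    obtain ⟨k, π, hπ⟩ := Module.Finite.exists_fin' R L
    have hS := shortExact_ofHom (Submodule.subtype_injective (LinearMap.ker π)) hπ
      (LinearMap.exact_subtype_ker_map π)
    have hproj : Projective (ModuleCat.of R (Fin k → R)) := inferInstance
    obtain ⟨η, hη⟩ := Ext.contravariant_sequence_exact₃ hS (ModuleCat.of R N) ξ
      -- Dimension shift: `ξ` is the connecting image of a class `η` of degree `i` on the syzygy
      -- module `ker π`.
      (Ext.eq_zero_of_projective _) (n₀ := i) (by lia)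
    obtain ⟨t₀, ht₀⟩ := ih (LinearMap.ker π) η
    -- Artin–Rees with constant `c`: the part of `ker π` inside `I^(t₀ + c) F` lies in `I^t₀ ker π`,
    -- where `η` vanishes.
    obtain ⟨c, hc⟩ := Ideal.exists_pow_inf_eq_pow_smul I (LinearMap.ker π)
    have hmap : ∀ x ∈ (I ^ (t₀ + c) • ⊤ : Submodule R (Fin k → R)),
        π x ∈ (I ^ (t₀ + c) • ⊤ : Submodule R L) := fun x hx ↦ by
      have := Submodule.mem_map_of_mem (f := π) hx
      rw [Submodule.map_smul''] at this
      exact Submodule.smul_mono le_rfl le_top this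
    obtain ⟨πt, hπt'⟩ : ∃ πt : (I ^ (t₀ + c) • ⊤ : Submodule R (Fin k → R)) →ₗ[R]
        (I ^ (t₀ + c) • ⊤ : Submodule R L), ∀ x, (πt x : L) = π x :=
      ⟨π.restrict hmap, fun _ ↦ rfl⟩
    have hπt : Function.Surjective πt := by
      rintro ⟨y, hy⟩
      rw [← LinearMap.range_eq_top.2 hπ, ← Submodule.map_top, ← Submodule.map_smul''] at hy
      obtain ⟨x, hx, hxy⟩ := hy
      exact ⟨⟨x, hx⟩, Subtype.ext ((hπt' _).trans hxy)⟩
    have hex : Function.Exact (LinearMap.ker πt).subtype πt := LinearMap.exact_subtype_ker_map πt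
    have hSt := @shortExact_ofHom R _ _ (LinearMap.ker πt) _ _ _ _ _ _ _
      (LinearMap.ker πt).subtype πt (Submodule.subtype_injective (LinearMap.ker πt)) hπt hex
    have hker : ∀ x : LinearMap.ker πt, π x.1.1 = 0 := fun x ↦
      (hπt' _).symm.trans (congrArg Subtype.val x.2)
    let τ₁ : LinearMap.ker πt →ₗ[R] LinearMap.ker π :=
      LinearMap.codRestrict _ (Submodule.subtype _ ∘ₗ Submodule.subtype _) hker
    have hτ₁ : ∀ x, τ₁ x ∈ (I ^ t₀ • ⊤ : Submodule R (LinearMap.ker π)) := fun x ↦ by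
      refine smul_top_eq_comap _ _ _ _ ?_
      have : x.1.1 ∈ I ^ (t₀ + c) • ⊤ ⊓ LinearMap.ker π := ⟨x.1.2, hker x⟩
      rw [hc _ (by lia), Nat.add_sub_cancel] at this
      exact Submodule.smul_mono le_rfl inf_le_right this
    refine ⟨t₀ + c, ?_⟩
    rw [← hη]
    exact mk₀_comp_extClass_comp_eq_zero hSt hS
      { τ₁ := ModuleCat.ofHom τ₁
        τ₂ := inclHom _
        τ₃ := inclHom _
        comm₁₂ := rfl
        comm₂₃ := ModuleCat.hom_ext (LinearMap.ext fun x ↦ (hπt' x).symm) } η _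
      (ModuleCat.ofHom (LinearMap.codRestrict _ τ₁ hτ₁)) (inclHom _) rfl ht₀

variable {N : Type u} [AddCommGroup N] [Module R N] {n : ℕ}

/-- A class in `Ext^(i+1)(R/I^t, N)` comes from `Ext^i(I^t, N)` and so dies on `I^s I^t = I^(s+t)`
for some `s`; hence it is zero in the limit. -/
lemma subsingleton_locCoh_succ_of_pow_smul_eq_zero [IsNoetherianRing R]
    (hN : ∀ a ∈ I ^ n, ∀ x : N, a • x = 0) (i : ℕ) : Subsingleton (LocCoh I (i + 1) N) := by
  refine subsingleton_of_forall_eq 0 fun x ↦ ?_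
  obtain ⟨t, e, rfl⟩ := ofExt_surjective x
  have hS (t : ℕ) := shortExact_ofHom (Submodule.subtype_injective (I ^ t))
    (Submodule.mkQ_surjective (I ^ t)) (LinearMap.exact_subtype_mkQ (I ^ t))
  have hproj : Projective (ModuleCat.of R R) := inferInstance
  obtain ⟨η, hη⟩ := Ext.contravariant_sequence_exact₃ (hS t) (ModuleCat.of R N) e
    (Ext.eq_zero_of_projective _) (n₀ := i) (by lia)
  obtain ⟨s, hs⟩ := exists_restrict_ext_eq_zero hN i (I ^ t : Ideal R) η
  have hle : t ≤ s + t := by lia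
  let τ₁ : (I ^ (s + t) : Ideal R) →ₗ[R] (I ^ t : Ideal R) :=
    Submodule.inclusion (Ideal.pow_le_pow_right hle)
  have hτ₁ : ∀ x, τ₁ x ∈ (I ^ s • ⊤ : Submodule R (I ^ t : Ideal R)) := fun x ↦ by
    refine smul_top_eq_comap _ _ _ _ ?_
    rw [smul_eq_mul, ← pow_add]
    exact x.2
  rw [← ofExt_precomp hle, ← hη]
  refine (congrArg _ ?_).trans (map_zero _)
  exact mk₀_comp_extClass_comp_eq_zero (hS (s + t)) (hS t)
    { τ₁ := ModuleCat.ofHom τ₁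
      τ₂ := 𝟙 _
      τ₃ := powQuotMap I hle
      comm₁₂ := rfl
      comm₂₃ := rfl } η _ (ModuleCat.ofHom (LinearMap.codRestrict _ τ₁ hτ₁)) (inclHom _) rfl hs

/-- The isomorphism evaluates homomorphisms `R/I^t → N` at 1; every element of `N` is already
reached at `t = n`. -/
lemma nonempty_locCoh_zero_equiv (hN : ∀ a ∈ I ^ n, ∀ x : N, a • x = 0) :
    Nonempty (LocCoh I 0 N ≃ₗ[R] N) := by
  let ev (t : ℕ) : (powQuot I t ⟶ ModuleCat.of R N) →ₗ[R] N :=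
    { toFun := fun h ↦ h.hom (Submodule.Quotient.mk 1)
      map_add' := fun _ _ ↦ rfl
      map_smul' := fun _ _ ↦ rfl }
  obtain ⟨ψ, hψ⟩ := exists_localCohomology_desc (I := I) (i := 0) (M := ModuleCat.of R N) (N := N)
    (fun t ↦ ev t ∘ₗ Ext.linearEquiv₀.toLinearMap) (fun s t h e ↦ by
      obtain ⟨f, rfl⟩ := Ext.linearEquiv₀.symm (R := R).surjective e
      have : (Ext.mk₀ (powQuotMap I h)).comp (Ext.mk₀ f) (zero_add 0) =
          Ext.linearEquiv₀ (R := R).symm (powQuotMap I h ≫ f) := by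
        rw [Ext.mk₀_comp_mk₀]; rfl
      have h2 : Ext.linearEquiv₀ (R := R).symm f = Ext.mk₀ f := rfl
      rw [h2, this]
      simp only [LinearMap.comp_apply, LinearEquiv.coe_coe, LinearEquiv.apply_symm_apply, ← h2]
      rfl)
  refine ⟨LinearEquiv.ofBijective ψ ⟨?_, fun y ↦ ?_⟩⟩
  · rw [injective_iff_map_eq_zero]
    intro x hx
    obtain ⟨t, e, rfl⟩ := ofExt_surjective x
    have h0 : ev t (Ext.linearEquiv₀ (R := R) e) = 0 := (hψ t e).symm.trans hx
    have h1 : Ext.linearEquiv₀ (R := R) e = 0 := by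
      refine ModuleCat.hom_ext (LinearMap.ext fun z ↦ ?_)
      obtain ⟨z, rfl⟩ := Submodule.Quotient.mk_surjective _ z
      have h2 : (Submodule.Quotient.mk z : R ⧸ I ^ t) = z • Submodule.Quotient.mk 1 := by
        rw [← Submodule.Quotient.mk_smul, smul_eq_mul, mul_one]
      rw [h2, map_smul]
      exact (congrArg (z • ·) h0).trans (smul_zero z)
    rw [(LinearEquiv.map_eq_zero_iff _).1 h1, map_zero]
  · let f : powQuot I n ⟶ ModuleCat.of R N := ModuleCat.ofHom
      (Submodule.liftQ _ (LinearMap.toSpanSingleton R N y) fun a ha ↦ hN a ha y)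
    refine ⟨ofExt I 0 _ n (Ext.linearEquiv₀ (R := R).symm f), (hψ _ _).trans ?_⟩
    simp only [LinearMap.comp_apply, LinearEquiv.coe_coe, LinearEquiv.apply_symm_apply]
    exact one_smul R y

end FiniteLength

/-! ### A Koszul multiplicity for Artinian modules. -/

section ArtinianMultiplicity

open Module Submodule
open scoped Pointwise

variable {R : Type u} [CommRing R]

/-- The alternating sum of lengths of the Koszul homology of a module on a list of elements. -/
noncomputable def koszulMult : List R → ∀ (H : Type u) [AddCommGroup H] [Module R H], ℤ
  -- Infinite length would count as 0; `IsParamList.length_ne_top` excludes it where additivity is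
  -- proved.
  | [], H, _, _ => (Module.length R H).toNat
  | x :: xs, H, _, _ => koszulMult xs (torsionBy R H x) - koszulMult xs (QuotSMulTop x H)

lemma koszulMult_nil (H : Type u) [AddCommGroup H] [Module R H] :
    koszulMult ([] : List R) H = (Module.length R H).toNat := rfl

lemma koszulMult_cons (x : R) (xs : List R) (H : Type u) [AddCommGroup H] [Module R H] :
    koszulMult (x :: xs) H =
      koszulMult xs (torsionBy R H x) - koszulMult xs (QuotSMulTop x H) := rfl

variable [IsLocalRing R]

/-- The list `xs` generates, together with the annihilator of the module, an ideal whose radical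
contains the maximal ideal. -/
def IsParamList (xs : List R) (H : Type u) [AddCommGroup H] [Module R H] : Prop :=
  IsLocalRing.maximalIdeal R ≤ (annihilator R H ⊔ Ideal.ofList xs).radical

variable {A B C H : Type u} [AddCommGroup A] [AddCommGroup B] [AddCommGroup C] [AddCommGroup H]
  [Module R A] [Module R B] [Module R C] [Module R H] {x : R} {xs : List R}

lemma IsParamList.of_injective (h : IsParamList xs B) (f : A →ₗ[R] B) (hf : Function.Injective f) :
    IsParamList xs A :=
  h.trans (Ideal.radical_mono (sup_le_sup_right (f.annihilator_le_of_injective hf) _))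

lemma IsParamList.of_surjective (h : IsParamList xs B) (f : B →ₗ[R] A)
    (hf : Function.Surjective f) : IsParamList xs A :=
  h.trans (Ideal.radical_mono (sup_le_sup_right (f.annihilator_le_of_surjective hf) _))

lemma IsParamList.tail (h : IsParamList (x :: xs) H) (hx : ∀ z : H, x • z = 0) :
    IsParamList xs H := by
  refine h.trans (Ideal.radical_mono ?_)
  rw [Ideal.ofList_cons, ← sup_assoc]
  refine sup_le_sup_right (sup_le le_rfl ?_) _
  rw [Ideal.span_singleton_le_iff_mem]
  exact Module.mem_annihilator.2 hx

lemma IsParamList.tail_of_pow (h : IsParamList (x :: xs) H) {n : ℕ}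
    (hx : ∀ z : H, x ^ n • z = 0) : IsParamList xs H := by
  refine h.trans (Ideal.radical_le_radical_iff.2 ?_)
  rw [Ideal.ofList_cons]
  refine sup_le (le_sup_left.trans Ideal.le_radical)
    (sup_le ?_ (le_sup_right.trans Ideal.le_radical))
  rw [Ideal.span_singleton_le_iff_mem]
  exact ⟨n, Ideal.mem_sup_left (Module.mem_annihilator.2 hx)⟩

lemma IsParamList.quotSMulTop (h : IsParamList (x :: xs) H) : IsParamList xs (QuotSMulTop x H) := by
  refine (h.of_surjective _ (mkQ_surjective (x • ⊤ : Submodule R H))).tail fun z ↦ ?_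
  obtain ⟨z, rfl⟩ := Submodule.Quotient.mk_surjective _ z
  rw [← Submodule.Quotient.mk_smul, Submodule.Quotient.mk_eq_zero]
  exact smul_mem_pointwise_smul z x _ trivial

lemma IsParamList.torsionBy (h : IsParamList (x :: xs) H) :
    IsParamList xs (torsionBy R H x) :=
  (h.of_injective _ (subtype_injective (Submodule.torsionBy R H x))).tail fun z ↦ smul_torsionBy x z

variable [IsNoetherianRing R]

lemma IsParamList.isArtinianRing_quotient (h : IsParamList ([] : List R) H) :
    IsArtinianRing (R ⧸ annihilator R H) := by
  rw [IsParamList, Ideal.ofList_nil, sup_bot_eq] at h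
  have : Ring.KrullDimLE 0 (R ⧸ annihilator R H) := by
    refine Ring.KrullDimLE.mk₀ fun P hP ↦ ?_
    have h1 : annihilator R H ≤ P.comap (Ideal.Quotient.mk _) := by
      intro r hr
      rw [Ideal.mem_comap, Ideal.Quotient.eq_zero_iff_mem.2 hr]
      exact P.zero_mem
    have hc : (P.comap (Ideal.Quotient.mk (annihilator R H))).IsPrime := hP.comap _
    have h2 : P.comap (Ideal.Quotient.mk (annihilator R H)) = IsLocalRing.maximalIdeal R :=
      le_antisymm (IsLocalRing.le_maximalIdeal hc.ne_top)
        (h.trans ((hc.radical_le_iff).2 h1))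
    have h3 : (P.comap (Ideal.Quotient.mk (annihilator R H))).IsMaximal := by
      rw [h2]; infer_instance
    have := Ideal.map_eq_top_or_isMaximal_of_surjective (Ideal.Quotient.mk (annihilator R H))
      Ideal.Quotient.mk_surjective h3
    rw [Ideal.map_comap_of_surjective _ Ideal.Quotient.mk_surjective] at this
    exact this.resolve_left hP.ne_top
  exact isArtinianRing_iff_isNoetherianRing_krullDimLE_zero.2 ⟨inferInstance, this⟩

/-- Hopkins–Levitzki over the Artinian ring `R / Ann H`. -/
lemma IsParamList.isNoetherian_iff_isArtinian (h : IsParamList ([] : List R) H) :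
    IsNoetherian R H ↔ IsArtinian R H := by
  let := quotientAnnihilator (R := R) (M := H)
  have := h.isArtinianRing_quotient
  have : IsScalarTower R (R ⧸ annihilator R H) H := ⟨fun r s z ↦ by
    obtain ⟨s, rfl⟩ := Ideal.Quotient.mk_surjective s
    exact mul_smul r s z⟩
  refine ⟨fun _ ↦ ?_, fun _ ↦ ?_⟩
  · have h1 : Module.Finite (R ⧸ annihilator R H) H := Module.Finite.of_restrictScalars_finite R _ _
    exact isArtinian_of_surjective_algebraMap (S := R) (R := R ⧸ annihilator R H)
      Ideal.Quotient.mk_surjective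
  · have h4 : IsArtinian (R ⧸ annihilator R H) H := isArtinian_of_tower R inferInstance
    have h5 : IsNoetherian (R ⧸ annihilator R H) H :=
      IsSemiprimaryRing.isNoetherian_iff_isArtinian.2 h4
    have h6 : Module.Finite R H := Module.Finite.trans (R ⧸ annihilator R H) H
    exact isNoetherian_of_isNoetherianRing_of_finite R H

lemma IsParamList.isNoetherian [IsArtinian R H] (h : IsParamList ([] : List R) H) :
    IsNoetherian R H :=
  h.isNoetherian_iff_isArtinian.2 inferInstance

lemma IsParamList.length_ne_top [IsArtinian R H] (h : IsParamList ([] : List R) H) :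
    Module.length R H ≠ ⊤ :=
  length_ne_top_iff.2 (isFiniteLength_iff_isNoetherian_isArtinian.2 ⟨h.isNoetherian, inferInstance⟩)

lemma koszulMult_nil_add [IsArtinian R B] (hB : IsParamList ([] : List R) B) (f : A →ₗ[R] B)
    (g : B →ₗ[R] C) (hf : Function.Injective f) (hg : Function.Surjective g)
    (hfg : Function.Exact f g) :
    koszulMult ([] : List R) B = koszulMult ([] : List R) A + koszulMult ([] : List R) C := by
  have h := Module.length_eq_add_of_exact f g hf hg hfg
  have h1 := hB.length_ne_top
  rw [h, Ne, ENat.add_eq_top, not_or] at h1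
  simp only [koszulMult_nil, h]
  rw [ENat.toNat_add h1.1 h1.2]
  push_cast
  rfl

/-- Multiplicity is additive on short exact sequences of Artinian modules. -/
theorem koszulMult_add [IsArtinian R B] (hB : IsParamList xs B) (f : A →ₗ[R] B)
    (g : B →ₗ[R] C) (hf : Function.Injective f) (hg : Function.Surjective g)
    (hfg : Function.Exact f g) : koszulMult xs B = koszulMult xs A + koszulMult xs C := by
  induction xs generalizing A B C with
  | nil => exact koszulMult_nil_add hB f g hf hg hfg
  | cons x xs ih =>
    have : IsArtinian R A := isArtinian_of_injective f hf
    have : IsArtinian R C := isArtinian_of_surjective B g hg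
    have split {X Y : Type u} [AddCommGroup X] [AddCommGroup Y] [Module R X] [Module R Y]
        [IsArtinian R X] (hX : IsParamList xs X) (φ : X →ₗ[R] Y) :
        koszulMult xs X = koszulMult xs (LinearMap.ker φ) + koszulMult xs (LinearMap.range φ) :=
      ih hX (LinearMap.ker φ).subtype φ.rangeRestrict (subtype_injective _)
        φ.surjective_rangeRestrict
        (by rw [LinearMap.exact_iff, LinearMap.ker_rangeRestrict, range_subtype])
    have eq_bot {Y : Type u} [AddCommGroup Y] [Module R Y] [IsArtinian R Y]
        (hY : IsParamList xs Y) (N : Submodule R Y) (hN : N = ⊥) : koszulMult xs N = 0 := by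
      subst hN
      -- Additivity on `0 → ⊥ → ⊥ → ⊥ → 0` reads `k = k + k`. Invariance under isomorphism is only
      -- derived later, from additivity.
      have := ih (hY.of_injective _ (subtype_injective (⊥ : Submodule R Y)))
        (LinearMap.id : (⊥ : Submodule R Y) →ₗ[R] _)
        (0 : (⊥ : Submodule R Y) →ₗ[R] (⊥ : Submodule R Y)) Function.injective_id
        (fun z ↦ ⟨0, Subsingleton.elim _ _⟩) (fun z ↦ ⟨fun _ ↦ ⟨z, rfl⟩, fun _ ↦ rfl⟩)
      lia
    have eq_top {Y : Type u} [AddCommGroup Y] [Module R Y] [IsArtinian R Y]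
        (hY : IsParamList xs Y) (N : Submodule R Y) (hN : N = ⊤) :
        koszulMult xs N = koszulMult xs Y := by
      subst hN
      have h1 := split hY (LinearMap.id : Y →ₗ[R] Y)
      rw [eq_bot hY _ LinearMap.ker_id] at h1
      rw [LinearMap.range_id] at h1
      lia
    have hA := hB.of_injective f hf
    have hC := hB.of_surjective g hg
    let α (X : Type u) [AddCommGroup X] [Module R X] : X →ₗ[R] X := LinearMap.lsmul R X x
    have tors {X Y : Type u} [AddCommGroup X] [AddCommGroup Y] [Module R X] [Module R Y]
        (φ : X →ₗ[R] Y) : ∀ z ∈ torsionBy R X x, φ z ∈ torsionBy R Y x := fun z hz ↦ by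
      rw [mem_torsionBy_iff] at hz ⊢
      rw [← map_smul, hz, map_zero]
    let f₀ : torsionBy R A x →ₗ[R] torsionBy R B x := f.restrict (tors f)
    let g₀ : torsionBy R B x →ₗ[R] torsionBy R C x := g.restrict (tors g)
    have hι (X : Type u) [AddCommGroup X] [Module R X] :
        Function.Exact (torsionBy R X x).subtype (α X) :=
      LinearMap.exact_subtype_ker_map _
    have hπ (X : Type u) [AddCommGroup X] [Module R X] :
        Function.Exact (α X) (x • ⊤ : Submodule R X).mkQ := by
      rw [LinearMap.exact_iff, ker_mkQ]
      ext z
      rw [mem_smul_pointwise_iff_exists]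
      exact ⟨fun ⟨y, _, hy⟩ ↦ ⟨y, hy⟩, fun ⟨y, hy⟩ ↦ ⟨y, trivial, hy⟩⟩
    have h₁ : f ∘ₗ α A = α B ∘ₗ f := LinearMap.ext fun z ↦ map_smul f x z
    have h₂ : g ∘ₗ α B = α C ∘ₗ g := LinearMap.ext fun z ↦ map_smul g x z
    -- The snake lemma for multiplication by `x` gives the six-term sequence `0 → A[x] → B[x] → C[x]
    -- → A/xA → B/xB → C/xC → 0`. Cutting it into kernels and images and applying the inductive
    -- hypothesis to each piece gives the claim.
    let δ := SnakeLemma.δ' (α A) (α B) (α C) f g hfg f g hfg h₁ h₂ _ (hι C) _ (hπ A) hg hf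
    have e₁ : Function.Exact f₀ g₀ := fun ⟨z, hz⟩ ↦ by
      refine ⟨fun h ↦ ?_, ?_⟩
      · obtain ⟨y, hy⟩ := (hfg z).1 (congrArg Subtype.val h)
        refine ⟨⟨y, ?_⟩, Subtype.ext hy⟩
        rw [mem_torsionBy_iff] at hz ⊢
        exact hf (by rw [map_smul, hy, hz, map_zero])
      · rintro ⟨y, hy⟩
        rw [← hy]
        exact Subtype.ext (hfg.apply_apply_eq_zero y.1)
    have e₂ : Function.Exact g₀ δ := SnakeLemma.exact_δ'_right (α A) (α B) (α C) f g hfg f g hfg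
      h₁ h₂ _ (hι B) _ (hι C) _ (hπ A) hg hf g₀ rfl (subtype_injective _)
    have e₃ : Function.Exact δ (QuotSMulTop.map x f) :=
      SnakeLemma.exact_δ'_left (α A) (α B) (α C) f g hfg f g hfg
        h₁ h₂ _ (hι C) _ (hπ A) _ (hπ B) hg hf (QuotSMulTop.map x f)
        (QuotSMulTop.map_comp_mkQ x f) (mkQ_surjective _)
    have e₄ : Function.Exact (QuotSMulTop.map x f) (QuotSMulTop.map x g) :=
      QuotSMulTop.map_exact x hfg hg
    have hf₀ : LinearMap.ker f₀ = ⊥ := LinearMap.ker_eq_bot.2 fun y z h ↦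
      Subtype.ext (hf (congrArg Subtype.val h))
    have hgx : LinearMap.range (QuotSMulTop.map x g) = ⊤ :=
      LinearMap.range_eq_top.2 (QuotSMulTop.map_surjective x hg)
    rw [LinearMap.exact_iff] at e₁ e₂ e₃ e₄
    have s₁ := split hA.torsionBy f₀
    have s₂ := split hB.torsionBy g₀
    have s₃ := split hC.torsionBy δ
    have s₄ := split hA.quotSMulTop (QuotSMulTop.map x f)
    have s₅ := split hB.quotSMulTop (QuotSMulTop.map x g)
    rw [eq_bot hA.torsionBy _ hf₀] at s₁
    rw [e₁] at s₂
    rw [e₂] at s₃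
    rw [e₃] at s₄
    rw [e₄, eq_top hC.quotSMulTop _ hgx] at s₅
    simp only [koszulMult_cons]
    lia

lemma koszulMult_eq_zero_of_subsingleton [Subsingleton H] : koszulMult xs H = 0 := by
  have hA : IsArtinian R H := inferInstance
  have hP : IsParamList xs H := by
    rw [IsParamList, annihilator_eq_top_iff.2 inferInstance, top_sup_eq, Ideal.radical_top]
    exact le_top
  have := koszulMult_add hP (LinearMap.id : H →ₗ[R] H) (0 : H →ₗ[R] H) Function.injective_id
    (fun z ↦ ⟨0, Subsingleton.elim _ _⟩)
    (fun z ↦ ⟨fun _ ↦ ⟨z, rfl⟩, fun _ ↦ Subsingleton.elim _ _⟩)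
  lia

lemma koszulMult_congr [IsArtinian R A] (hA : IsParamList xs A) (e : A ≃ₗ[R] B) :
    koszulMult xs A = koszulMult xs B := by
  have := koszulMult_add hA (⊥ : Submodule R A).subtype e.toLinearMap (subtype_injective _)
    e.surjective (by rw [LinearMap.exact_iff, range_subtype]; exact e.ker)
  rw [koszulMult_eq_zero_of_subsingleton (H := (⊥ : Submodule R A)), zero_add] at this
  exact this

lemma koszulMult_ker_add_range [IsArtinian R A] (hA : IsParamList xs A) (f : A →ₗ[R] B) :
    koszulMult xs A = koszulMult xs (LinearMap.ker f) + koszulMult xs (LinearMap.range f) :=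
  koszulMult_add hA (LinearMap.ker f).subtype f.rangeRestrict (subtype_injective _)
    f.surjective_rangeRestrict
    (by rw [LinearMap.exact_iff, LinearMap.ker_rangeRestrict, range_subtype])

lemma koszulMult_submodule_add_quotient [IsArtinian R A] (hA : IsParamList xs A)
    (N : Submodule R A) : koszulMult xs A = koszulMult xs N + koszulMult xs (A ⧸ N) :=
  koszulMult_add hA N.subtype N.mkQ (subtype_injective _) (mkQ_surjective _)
    (LinearMap.exact_subtype_mkQ N)

/-- Both `H[x]` and `H/xH` are all of `H`, so their contributions cancel. -/
lemma koszulMult_cons_eq_zero_of_smul_eq_zero [IsArtinian R H] (hH : IsParamList (x :: xs) H)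
    (hx : ∀ z : H, x • z = 0) : koszulMult (x :: xs) H = 0 := by
  have h1 : torsionBy R H x = ⊤ := eq_top_iff.2 fun z _ ↦ hx z
  have h2 : (x • ⊤ : Submodule R H) = ⊥ := by
    rw [eq_bot_iff]
    intro z hz
    obtain ⟨y, _, rfl⟩ := (mem_smul_pointwise_iff_exists _ _ _).1 hz
    exact hx y
  have hP := hH.tail hx
  rw [koszulMult_cons, koszulMult_congr hH.torsionBy (LinearEquiv.ofTop _ h1),
    koszulMult_congr hH.quotSMulTop (quotEquivOfEqBot _ h2), sub_self]

lemma koszulMult_cons_eq_zero_of_pow_smul_eq_zero [IsArtinian R H]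
    (hH : IsParamList (x :: xs) H) {n : ℕ} (hx : ∀ z : H, x ^ n • z = 0) :
    koszulMult (x :: xs) H = 0 := by
  induction n generalizing H with
  | zero =>
    have : Subsingleton H := subsingleton_of_forall_eq 0 fun z ↦ by simpa using hx z
    exact koszulMult_eq_zero_of_subsingleton
  | succ n ih =>
    rw [koszulMult_submodule_add_quotient hH (torsionBy R H x),
      koszulMult_cons_eq_zero_of_smul_eq_zero (hH.of_injective _ (subtype_injective _))
        (fun z ↦ smul_torsionBy x z), zero_add]
    have hS := mkQ_surjective (torsionBy R H x)
    have : IsArtinian R (H ⧸ torsionBy R H x) := inferInstance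
    have h1 := ih (hH.of_injective _ (subtype_injective (LinearMap.range (LinearMap.lsmul R H x))))
      (fun ⟨z, y, hy⟩ ↦ Subtype.ext (by
        change x ^ n • z = 0
        rw [← hy]
        change x ^ n • x • y = 0
        rw [smul_smul, ← pow_succ, hx]))
    rw [← h1]
    -- `H/H[x] ≅ xH`, which is killed by `x ^ n`.
    exact koszulMult_congr (hH.of_surjective _ hS)
      (LinearMap.quotKerEquivRange (LinearMap.lsmul R H x))

/-- Multiplicity of Artinian modules is nonnegative. -/
theorem koszulMult_nonneg [IsArtinian R H] (hH : IsParamList xs H) : 0 ≤ koszulMult xs H := by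
  induction xs generalizing H with
  | nil => exact Int.natCast_nonneg _
  | cons x xs ih =>
    -- The stable image `D = x^n H` satisfies `xD = D`, and `H/D` is killed by `x^n`. So only `D[x]`
    -- contributes.
    obtain ⟨n, hn⟩ := IsArtinian.range_smul_pow_stabilizes H x
    let D := LinearMap.range (x ^ n • (LinearMap.id : H →ₗ[R] H))
    rw [koszulMult_submodule_add_quotient hH D,
      koszulMult_cons_eq_zero_of_pow_smul_eq_zero (n := n) (hH.of_surjective _ (mkQ_surjective D))
        (fun z ↦ by
          obtain ⟨z, rfl⟩ := Submodule.Quotient.mk_surjective _ z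
          rw [← Submodule.Quotient.mk_smul, Submodule.Quotient.mk_eq_zero]
          exact ⟨z, rfl⟩), add_zero, koszulMult_cons]
    have hD := hH.of_injective _ (subtype_injective D)
    have : Subsingleton (QuotSMulTop x D) := by
      rw [Submodule.Quotient.subsingleton_iff, eq_top_iff]
      rintro ⟨z, hz⟩ -
      have hz' := hz
      rw [show D = _ from hn (n + 1) (by lia)] at hz'
      obtain ⟨y, hy⟩ := hz'
      refine (mem_smul_pointwise_iff_exists _ _ _).2 ⟨⟨x ^ n • y, y, rfl⟩, trivial, ?_⟩
      refine Subtype.ext (Eq.trans ?_ hy)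
      change x • x ^ n • y = x ^ (n + 1) • y
      rw [smul_smul, ← pow_succ']
    rw [koszulMult_eq_zero_of_subsingleton (H := QuotSMulTop x D), sub_zero]
    exact ih hD.torsionBy

lemma koszulMult_eq_zero_of_injective [IsArtinian R B] (hB : IsParamList xs B) (f : A →ₗ[R] B)
    (hf : Function.Injective f) (h : koszulMult xs B = 0) : koszulMult xs A = 0 := by
  have : IsArtinian R A := isArtinian_of_injective f hf
  have h1 := koszulMult_add hB f (LinearMap.range f).mkQ hf (mkQ_surjective _)
    (by rw [LinearMap.exact_iff, ker_mkQ])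
  have h2 := koszulMult_nonneg (hB.of_injective f hf)
  have h3 := koszulMult_nonneg (hB.of_surjective _ (mkQ_surjective (LinearMap.range f)))
  lia

lemma koszulMult_eq_zero_of_surjective [IsArtinian R B] (hB : IsParamList xs B) (g : B →ₗ[R] C)
    (hg : Function.Surjective g) (h : koszulMult xs B = 0) : koszulMult xs C = 0 := by
  have : IsArtinian R C := isArtinian_of_surjective B g hg
  have h1 := koszulMult_add hB (LinearMap.ker g).subtype g (subtype_injective _) hg
    (LinearMap.exact_subtype_ker_map g)
  have h2 := koszulMult_nonneg (hB.of_surjective g hg)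
  have h3 := koszulMult_nonneg (hB.of_injective _ (subtype_injective (LinearMap.ker g)))
  lia

lemma koszulMult_range_eq_zero [IsArtinian R A] (hA : IsParamList xs A) (f : A →ₗ[R] B)
    (h : koszulMult xs A = 0) : koszulMult xs (LinearMap.range f) = 0 :=
  koszulMult_eq_zero_of_surjective hA f.rangeRestrict f.surjective_rangeRestrict h

/-- If the outer terms of a four-term exact sequence have multiplicity zero, then the inner terms
have the same multiplicity. -/
lemma koszulMult_eq_of_exact {D : Type u} [AddCommGroup D] [Module R D] [IsArtinian R A]
    [IsArtinian R B] [IsArtinian R C] [IsArtinian R D] (hA : IsParamList xs A)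
    (hB : IsParamList xs B) (hC : IsParamList xs C) (hD : IsParamList xs D) (f : A →ₗ[R] B)
    (g : B →ₗ[R] C) (h : C →ₗ[R] D) (hfg : Function.Exact f g) (hgh : Function.Exact g h)
    (hA0 : koszulMult xs A = 0) (hD0 : koszulMult xs D = 0) :
    koszulMult xs B = koszulMult xs C := by
  rw [LinearMap.exact_iff] at hfg hgh
  have h1 := koszulMult_ker_add_range hB g
  have h2 := koszulMult_ker_add_range hC h
  rw [hfg, koszulMult_range_eq_zero hA f hA0] at h1
  rw [hgh, koszulMult_eq_zero_of_injective hD _ (subtype_injective (LinearMap.range h)) hD0] at h2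
  lia

/-- A module on which every element is killed by a power of `y`, and in which the elements killed
by `y` form an Artinian submodule, is Artinian. -/
theorem isArtinian_of_torsionBy {S : Type*} [CommRing S] {H : Type*} [AddCommGroup H] [Module S H]
    (y : S) (hy : ∀ z : H, ∃ n, y ^ n • z = 0) [IsArtinian S (torsionBy S H y)] :
    IsArtinian S H := by
  rw [← monotone_stabilizes_iff_artinian]
  intro U'
  let U : ℕ → Submodule S H := fun i ↦ U' i
  -- `G V n` is `y^n V ∩ H[y]`, and `G (U i) n` decreases in both `i` and `n`. It stabilises along
  -- the diagonal from `N` on, and for each of the finitely many `n < N` separately, so a single `K`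
  -- works for all `n`.
  let G (V : Submodule S H) (n : ℕ) : Submodule S (torsionBy S H y) :=
    (V.map (y ^ n • (LinearMap.id : H →ₗ[S] H))).comap (torsionBy S H y).subtype
  have hG {V V' : Submodule S H} (hV : V' ≤ V) {n n' : ℕ} (hn : n ≤ n') : G V' n' ≤ G V n := by
    rintro z ⟨v, hv, hvz⟩
    refine ⟨y ^ (n' - n) • v, V.smul_mem _ (hV hv), Eq.trans ?_ hvz⟩
    change y ^ n • y ^ (n' - n) • v = y ^ n' • v
    rw [smul_smul, ← pow_add, Nat.add_sub_cancel' hn]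
  have hU {i j : ℕ} (h : i ≤ j) : U j ≤ U i := U'.monotone h
  have stab (φ : ℕ → Submodule S (torsionBy S H y)) (hφ : ∀ i j, i ≤ j → φ j ≤ φ i) :
      ∃ n, ∀ m, n ≤ m → φ n = φ m := IsArtinian.monotone_stabilizes
        (⟨φ, fun i j h ↦ hφ i j h⟩ : ℕ →o (Submodule S (torsionBy S H y))ᵒᵈ)
  obtain ⟨N, hN⟩ := stab (fun i ↦ G (U i) i) fun i j h ↦ hG (hU h) h
  choose k hk using fun n ↦ stab (fun i ↦ G (U i) n) fun i j h ↦ hG (hU h) le_rfl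
  obtain ⟨K, hNK, hK⟩ : ∃ K, N ≤ K ∧ ∀ n < N, k n ≤ K :=
    ⟨N + ∑ n ∈ Finset.range N, k n, by lia, fun n hn ↦
      (Finset.single_le_sum (f := k) (fun _ _ ↦ Nat.zero_le _) (Finset.mem_range.2 hn)).trans
        (by lia)⟩
  have key : ∀ i, K ≤ i → ∀ n, G (U K) n = G (U i) n := fun i hi n ↦ by
    by_cases hn : n < N
    · rw [← hk n K (hK n hn), ← hk n i ((hK n hn).trans hi)]
    · push Not at hn
      refine le_antisymm ?_ (hG (hU hi) le_rfl)
      calc G (U K) n ≤ G (U N) N := hG (hU hNK) hn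
        _ = G (U (max i n)) (max i n) := hN _ (by lia)
        _ ≤ G (U i) n := hG (hU (le_max_left _ _)) (le_max_right _ _)
  refine ⟨K, fun i hi ↦ le_antisymm (α := Submodule S H) ?_ (hU hi)⟩
  -- The invariants `G` determine the submodule: if `y^(n+1) z = 0`, subtract an element of `U i`
  -- with the same `y^n`-multiple.
  · suffices h : ∀ n, ∀ z ∈ U K, y ^ n • z = 0 → z ∈ U i by
      intro z hz
      obtain ⟨n, hn⟩ := hy z
      exact h n z hz hn
    intro n
    induction n with
    | zero => intro z _ hz; rw [pow_zero, one_smul] at hz; rw [hz]; exact Submodule.zero_mem _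
    | succ n ih =>
      intro z hz hzn
      have h1 : y ^ n • z ∈ torsionBy S H y := by
        rw [mem_torsionBy_iff, smul_smul, ← pow_succ', hzn]
      have h2 : (⟨_, h1⟩ : torsionBy S H y) ∈ G (U K) n := ⟨z, hz, rfl⟩
      rw [key i hi n] at h2
      obtain ⟨w, hw, hwz⟩ := h2
      have hwz' : y ^ n • w = y ^ n • z := hwz
      have h3 := ih (z - w) (Submodule.sub_mem _ hz (hU hi hw)) (by rw [smul_sub, hwz', sub_self])
      have := Submodule.add_mem _ h3 hw
      rwa [sub_add_cancel] at this

end ArtinianMultiplicity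

/-! ### Vanishing, Artinianness and multiplicity of local cohomology. -/

section LocalCohomologyMultiplicity

open Module Submodule IsLocalRing
open scoped Pointwise

variable {R : Type u} [CommRing R]

section Sequence

variable {N : Type u} [AddCommGroup N] [Module R N] {x : R} (I : Ideal R)

/-- For an `N`-regular element `x`, the cokernel of `x` on `H^i(N)` and the kernel of `x` on
`H^(i+1)(N)` are the outer terms of a short exact sequence with middle term `H^i(N/xN)`. -/
lemma exists_locCoh_quotSMulTop_exact (hx : IsSMulRegular N x) (i : ℕ) :
    ∃ (φ : QuotSMulTop x (LocCoh I i N) →ₗ[R] LocCoh I i (QuotSMulTop x N))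
      (ψ : LocCoh I i (QuotSMulTop x N) →ₗ[R] torsionBy R (LocCoh I (i + 1) N) x),
      Function.Injective φ ∧ Function.Surjective ψ ∧ Function.Exact φ ψ := by
  have hf : Function.Injective (x • LinearMap.id : N →ₗ[R] N) := hx
  have hfg : Function.Exact (x • LinearMap.id : N →ₗ[R] N) (x • ⊤ : Submodule R N).mkQ := by
    rw [LinearMap.exact_iff, ker_mkQ]
    ext z
    rw [mem_smul_pointwise_iff_exists]
    exact ⟨fun ⟨y, _, hy⟩ ↦ ⟨y, hy⟩, fun ⟨y, hy⟩ ↦ ⟨y, trivial, hy⟩⟩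
  have h1 := locCohMap_exact (I := I) (i := i) hf (mkQ_surjective _) hfg
  obtain ⟨δ, h2, h3⟩ := exists_locCoh_connecting (I := I) (i := i) hf (mkQ_surjective _) hfg
  let π : LocCoh I i N →ₗ[R] LocCoh I i (QuotSMulTop x N) := locCohMap I i (mkQ _)
  have hker : (x • ⊤ : Submodule R (LocCoh I i N)) = LinearMap.ker π := by
    ext z
    rw [mem_smul_pointwise_iff_exists]
    refine ⟨fun ⟨y, _, hy⟩ ↦ (h1 z).2 ⟨y, (locCohMap_smul_id x y).trans hy⟩, fun hz ↦ ?_⟩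
    obtain ⟨y, hy⟩ := (h1 z).1 hz
    exact ⟨y, trivial, (locCohMap_smul_id x y).symm.trans hy⟩
  have hδ : ∀ z, δ z ∈ torsionBy R (LocCoh I (i + 1) N) x := fun z ↦
    (mem_torsionBy_iff _ _).2 ((locCohMap_smul_id x (δ z)).symm.trans (h3.apply_apply_eq_zero z))
  refine ⟨liftQ _ π hker.le, LinearMap.codRestrict _ δ hδ, ?_, ?_, ?_⟩
  · rw [← LinearMap.ker_eq_bot, ker_liftQ_eq_bot _ _ _ hker.ge]
  · rintro ⟨z, hz⟩
    obtain ⟨y, hy⟩ := (h3 z).1 ((locCohMap_smul_id x z).trans hz)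
    exact ⟨y, Subtype.ext hy⟩
  · rw [LinearMap.exact_iff, range_liftQ, LinearMap.ker_codRestrict]
    exact LinearMap.exact_iff.1 h2

lemma subsingleton_torsionBy_locCoh_zero (hx : IsSMulRegular N x) :
    Subsingleton (torsionBy R (LocCoh I 0 N) x) := by
  have hf : Function.Injective (x • LinearMap.id : N →ₗ[R] N) := hx
  refine subsingleton_of_forall_eq 0 fun ⟨z, hz⟩ ↦ Subtype.ext ?_
  refine locCohMap_zero_injective (I := I) hf (((locCohMap_smul_id x z).trans hz).trans ?_)
  exact (map_zero _).symm

end Sequence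

/-- Inductions on the parameter list split `M` into `U = M[x^n]`, killed by a power of `x`, and
`M/U`, on which `x` is regular. -/
lemma exists_isSMulRegular_quotient_torsionBy (x : R) (M : Type u) [AddCommGroup M] [Module R M]
    [IsNoetherian R M] : ∃ n, IsSMulRegular (M ⧸ torsionBy R M (x ^ n)) x := by
  obtain ⟨n, hn⟩ := monotone_stabilizes_iff_noetherian.2 ‹IsNoetherian R M›
    ⟨fun n ↦ torsionBy R M (x ^ n), fun i j h z hz ↦ by
      rw [mem_torsionBy_iff] at hz ⊢
      rw [← Nat.sub_add_cancel h, pow_add, mul_smul, hz, smul_zero]⟩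
  refine ⟨n, isSMulRegular_iff_right_eq_zero_of_smul.2 fun z hz ↦ ?_⟩
  obtain ⟨z, rfl⟩ := Submodule.Quotient.mk_surjective _ z
  rw [← Submodule.Quotient.mk_smul, Submodule.Quotient.mk_eq_zero, mem_torsionBy_iff, smul_smul,
    ← pow_succ] at hz
  rw [Submodule.Quotient.mk_eq_zero]
  have h : torsionBy R M (x ^ n) = torsionBy R M (x ^ (n + 1)) := hn (n + 1) (by lia)
  rw [h]
  exact hz

lemma subsingleton_of_torsionBy {x : R} {H : Type*} [AddCommGroup H] [Module R H]
    (hx : ∀ z : H, ∃ n, x ^ n • z = 0) [Subsingleton (torsionBy R H x)] : Subsingleton H := by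
  refine subsingleton_of_forall_eq 0 fun z ↦ ?_
  obtain ⟨n, hn⟩ := hx z
  induction n with
  | zero => simpa using hn
  | succ n ih =>
    refine ih ?_
    have h : x • x ^ n • z = 0 := by rw [smul_smul, ← pow_succ', hn]
    exact congrArg Subtype.val (Subsingleton.elim (⟨_, h⟩ : torsionBy R H x) 0)

/-- A chain of primes stays in whichever of the two supports contains its first member. -/
lemma le_supportDim_or_of_exact {M M' M'' : Type u} [AddCommGroup M] [Module R M]
    [AddCommGroup M'] [Module R M'] [AddCommGroup M''] [Module R M'']
    {f : M' →ₗ[R] M} {g : M →ₗ[R] M''} (hf : Function.Injective f)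
    (hg : Function.Surjective g) (hfg : Function.Exact f g) {d : ℕ}
    (hd : d ≤ supportDim R M) : d ≤ supportDim R M' ∨ d ≤ supportDim R M'' := by
  obtain ⟨s, hs⟩ := Order.le_krullDim_iff.1 hd
  have key {N : Type u} [AddCommGroup N] [Module R N] (h : s.head.1 ∈ support R N) :
      d ≤ supportDim R N :=
    Order.le_krullDim_iff.2 ⟨⟨s.length, fun i ↦ ⟨(s i).1, mem_support_mono (LTSeries.head_le s i) h⟩,
      fun i ↦ s.step i⟩, hs⟩
  have h := Set.ext_iff.1 (support_of_exact hfg hf hg) s.head.1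
  exact (h.1 s.head.2).imp key key

variable [IsLocalRing R] {M : Type u} [AddCommGroup M] [Module R M] {x : R} {xs : List R}

lemma IsParamList.locCoh (h : IsParamList xs M) (i : ℕ) :
    IsParamList xs (LocCoh (maximalIdeal R) i M) :=
  h.trans (Ideal.radical_mono (sup_le_sup_right annihilator_le_annihilator_locCoh _))

lemma exists_pow_smul_locCoh_eq_zero_of_mem (hx : x ∈ maximalIdeal R) {i : ℕ}
    (z : LocCoh (maximalIdeal R) i M) : ∃ n, x ^ n • z = 0 := by
  obtain ⟨t, ht⟩ := exists_pow_smul_locCoh_eq_zero z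
  exact ⟨t, ht _ (Ideal.pow_mem_pow hx t)⟩

variable [IsNoetherianRing R] 

lemma IsParamList.exists_pow_smul_eq_zero (h : IsParamList ([] : List R) M) :
    ∃ n, ∀ a ∈ maximalIdeal R ^ n, ∀ z : M, a • z = 0 := by
  rw [IsParamList, Ideal.ofList_nil, sup_bot_eq] at h
  obtain ⟨n, hn⟩ := Ideal.exists_pow_le_of_le_radical_of_fg h (IsNoetherian.noetherian _)
  exact ⟨n, fun a ha ↦ Module.mem_annihilator.1 (hn ha)⟩

/-- On `N = M/U`, the kernel of `x` on `H^i(N)` is a quotient of `H^(i-1)(N/xN) = 0`, while every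
element of `H^i(N)` is killed by a power of `x`. On `U` the shorter list `xs` suffices. -/
theorem subsingleton_locCoh_of_length_lt [Module.Finite R M] (hxs : ∀ x ∈ xs, x ∈ maximalIdeal R)
    (h : IsParamList xs M) {i : ℕ} (hi : xs.length < i) :
    Subsingleton (LocCoh (maximalIdeal R) i M) := by
  obtain ⟨j, rfl⟩ : ∃ j, i = j + 1 := ⟨i - 1, by lia⟩
  induction xs generalizing M j with
  | nil =>
    obtain ⟨n, hn⟩ := h.exists_pow_smul_eq_zero
    exact subsingleton_locCoh_succ_of_pow_smul_eq_zero hn j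
  | cons x xs ih =>
    simp only [List.length_cons, add_lt_add_iff_right] at hi
    have hxs' : ∀ x ∈ xs, x ∈ maximalIdeal R := fun y hy ↦ hxs y (List.mem_cons_of_mem _ hy)
    have hx : x ∈ maximalIdeal R := hxs x List.mem_cons_self
    obtain ⟨n, hn⟩ := exists_isSMulRegular_quotient_torsionBy x M
    set U := torsionBy R M (x ^ n)
    have hU : IsParamList xs U :=
      (h.of_injective _ (subtype_injective U)).tail_of_pow (n := n) fun z ↦ smul_torsionBy _ z
    have h1 := ih hxs' hU j (by lia)
    have h2 := h.of_surjective _ (mkQ_surjective U)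
    obtain ⟨k, rfl⟩ : ∃ k, j = k + 1 := ⟨j - 1, by lia⟩
    have h3 := ih hxs' h2.quotSMulTop k (by lia)
    obtain ⟨φ, ψ, -, hψ, -⟩ := exists_locCoh_quotSMulTop_exact (maximalIdeal R) hn (k + 1)
    have h4 := hψ.subsingleton
    have h5 : Subsingleton (LocCoh (maximalIdeal R) (k + 1 + 1) (M ⧸ U)) :=
      subsingleton_of_torsionBy (exists_pow_smul_locCoh_eq_zero_of_mem hx)
    refine subsingleton_of_forall_eq 0 fun z ↦ ?_
    obtain ⟨y, hy⟩ := (locCohMap_exact (I := maximalIdeal R) (i := k + 1 + 1)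
      (subtype_injective U) (mkQ_surjective U) (LinearMap.exact_subtype_mkQ U) z).1
        (Subsingleton.elim _ _)
    rw [← hy, Subsingleton.elim y 0, map_zero]

/-- The same splitting of `M`: `H^i(N)[x]` is a quotient of the Artinian module `H^(i-1)(N/xN)`, and
`isArtinian_of_torsionBy` lifts this to `H^i(N)`. -/
theorem isArtinian_locCoh [Module.Finite R M] (hxs : ∀ x ∈ xs, x ∈ maximalIdeal R)
    (h : IsParamList xs M) (i : ℕ) :
    IsArtinian R (LocCoh (maximalIdeal R) i M) := by
  induction xs generalizing M i with
  | nil =>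
    cases i with
    | zero =>
      obtain ⟨n, hn⟩ := h.exists_pow_smul_eq_zero
      obtain ⟨e⟩ := nonempty_locCoh_zero_equiv hn
      have : IsArtinian R M := h.isNoetherian_iff_isArtinian.1 inferInstance
      exact isArtinian_of_injective e.toLinearMap e.injective
    | succ j =>
      have := subsingleton_locCoh_of_length_lt hxs h (i := j + 1) (by simp)
      infer_instance
  | cons x xs ih =>
    have hxs' : ∀ x ∈ xs, x ∈ maximalIdeal R := fun y hy ↦ hxs y (List.mem_cons_of_mem _ hy)
    have hx : x ∈ maximalIdeal R := hxs x List.mem_cons_self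
    obtain ⟨n, hn⟩ := exists_isSMulRegular_quotient_torsionBy x M
    set U := torsionBy R M (x ^ n)
    have hU : IsParamList xs U :=
      (h.of_injective _ (subtype_injective U)).tail_of_pow (n := n) fun z ↦ smul_torsionBy _ z
    have h1 := ih hxs' hU i
    have h2 := h.of_surjective _ (mkQ_surjective U)
    have h4 : IsArtinian R (torsionBy R (LocCoh (maximalIdeal R) i (M ⧸ U)) x) := by
      cases i with
      | zero =>
        have := subsingleton_torsionBy_locCoh_zero (maximalIdeal R) hn
        infer_instance
      | succ k =>
        have h3 := ih hxs' h2.quotSMulTop k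
        obtain ⟨φ, ψ, -, hψ, -⟩ := exists_locCoh_quotSMulTop_exact (maximalIdeal R) hn k
        exact isArtinian_of_surjective _ ψ hψ
    have h5 : IsArtinian R (LocCoh (maximalIdeal R) i (M ⧸ U)) :=
      isArtinian_of_torsionBy x (exists_pow_smul_locCoh_eq_zero_of_mem hx)
    exact isArtinian_of_range_eq_ker _ _ (LinearMap.exact_iff.1
      (locCohMap_exact (I := maximalIdeal R) (i := i)
        (subtype_injective U) (mkQ_surjective U) (LinearMap.exact_subtype_mkQ U))).symm

lemma koszulMult_torsionBy_locCoh_eq_zero [Module.Finite R M] (hxs : ∀ x ∈ xs, x ∈ maximalIdeal R)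
    (h : IsParamList (x :: xs) M) (hx : IsSMulRegular M x) (i : ℕ)
    (h0 : ∀ j, j + 1 = i → koszulMult xs (LocCoh (maximalIdeal R) j (QuotSMulTop x M)) = 0) :
    koszulMult xs (torsionBy R (LocCoh (maximalIdeal R) i M) x) = 0 := by
  cases i with
  | zero =>
    have := subsingleton_torsionBy_locCoh_zero (maximalIdeal R) hx
    exact koszulMult_eq_zero_of_subsingleton
  | succ k =>
    obtain ⟨φ, ψ, -, hψ, -⟩ := exists_locCoh_quotSMulTop_exact (maximalIdeal R) hx k
    have := isArtinian_locCoh hxs h.quotSMulTop k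
    exact koszulMult_eq_zero_of_surjective (h.quotSMulTop.locCoh k) ψ hψ (h0 k rfl)

/-- The cohomology of `U` contributes nothing. For `N = M/U` the `x`-torsion term vanishes by
induction, so the multiplicity is minus that of a quotient; being also nonnegative, it is zero. -/
theorem koszulMult_locCoh_eq_zero_of_lt_length [Module.Finite R M]
    (hxs : ∀ x ∈ xs, x ∈ maximalIdeal R)
    (h : IsParamList xs M) {i : ℕ} (hi : i < xs.length) :
    koszulMult xs (LocCoh (maximalIdeal R) i M) = 0 := by
  induction xs generalizing M i with
  | nil => simp at hi
  | cons x xs ih =>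
    have hxs' : ∀ x ∈ xs, x ∈ maximalIdeal R := fun y hy ↦ hxs y (List.mem_cons_of_mem _ hy)
    obtain ⟨n, hn⟩ := exists_isSMulRegular_quotient_torsionBy x M
    set U := torsionBy R M (x ^ n)
    have hU := h.of_injective _ (subtype_injective U)
    have hN := h.of_surjective _ (mkQ_surjective U)
    have hA (i : ℕ) := isArtinian_locCoh hxs hU i
    have hB := isArtinian_locCoh hxs h i
    have hC := isArtinian_locCoh hxs hN i
    have hann : x ^ n ∈ annihilator R U := Module.mem_annihilator.2 fun z ↦ smul_torsionBy _ z
    have hkill (i : ℕ) (z : LocCoh (maximalIdeal R) i U) : x ^ n • z = 0 :=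
      Module.mem_annihilator.1 (annihilator_le_annihilator_locCoh hann) z
    have hU0 (i : ℕ) : koszulMult (x :: xs) (LocCoh (maximalIdeal R) i U) = 0 :=
      koszulMult_cons_eq_zero_of_pow_smul_eq_zero (n := n) (hU.locCoh i) (hkill i)
    obtain ⟨δ, h2, -⟩ := exists_locCoh_connecting (I := maximalIdeal R) (i := i)
      (subtype_injective U) (mkQ_surjective U) (LinearMap.exact_subtype_mkQ U)
    have h1 := locCohMap_exact (I := maximalIdeal R) (i := i)
      (subtype_injective U) (mkQ_surjective U) (LinearMap.exact_subtype_mkQ U)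
    have := hA i
    have := hA (i + 1)
    rw [koszulMult_eq_of_exact (hU.locCoh i) (h.locCoh i) (hN.locCoh i) (hU.locCoh (i + 1)) _ _ δ
      h1 h2 (hU0 _) (hU0 _)]
    refine le_antisymm ?_ (koszulMult_nonneg (hN.locCoh i))
    rw [koszulMult_cons, koszulMult_torsionBy_locCoh_eq_zero hxs' hN hn i fun j hj ↦
      ih hxs' hN.quotSMulTop (by simp at hi; lia)]
    have := koszulMult_nonneg (hN.locCoh i).quotSMulTop
    lia

variable {M' M'' : Type u} [AddCommGroup M'] [Module R M'] [AddCommGroup M''] [Module R M'']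

/-- The multiplicity of top local cohomology is additive on short exact sequences. -/
theorem koszulMult_locCoh_add [Module.Finite R M] [Module.Finite R M'] [Module.Finite R M'']
    (hxs : ∀ x ∈ xs, x ∈ maximalIdeal R) (h : IsParamList xs M)
    {f : M' →ₗ[R] M} {g : M →ₗ[R] M''} (hf : Function.Injective f)
    (hg : Function.Surjective g) (hfg : Function.Exact f g) :
    koszulMult xs (LocCoh (maximalIdeal R) xs.length M) =
      koszulMult xs (LocCoh (maximalIdeal R) xs.length M') +
      koszulMult xs (LocCoh (maximalIdeal R) xs.length M'') := by
  have h' := h.of_injective f hf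
  have h'' := h.of_surjective g hg
  have hA (i : ℕ) := isArtinian_locCoh hxs h i
  have hA' (i : ℕ) := isArtinian_locCoh hxs h' i
  have hA'' (i : ℕ) := isArtinian_locCoh hxs h'' i
  have hV' := subsingleton_locCoh_of_length_lt hxs h' (Nat.lt_succ_self _)
  have e1 := locCohMap_exact (I := maximalIdeal R) (i := xs.length) hf hg hfg
  obtain ⟨δ, e2, -⟩ := exists_locCoh_connecting (I := maximalIdeal R) (i := xs.length) hf hg hfg
  have s1 := koszulMult_add (h.locCoh xs.length)
    (LinearMap.range (locCohMap (maximalIdeal R) xs.length f)).subtype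
    (locCohMap (maximalIdeal R) xs.length g) (subtype_injective _)
    (fun z ↦ (e2 z).1 (Subsingleton.elim _ _))
    (by rw [LinearMap.exact_iff, range_subtype]; exact LinearMap.exact_iff.1 e1)
  have s2 := koszulMult_ker_add_range (h'.locCoh xs.length)
    (locCohMap (maximalIdeal R) xs.length f)
  -- The only defect of left exactness in top degree is the image of `H^(d-1)(M'')`, whose
  -- multiplicity is zero. For `d = 0` there is no defect.
  suffices koszulMult xs (LinearMap.ker (locCohMap (maximalIdeal R) xs.length f)) = 0 by lia
  by_cases hl : xs.length = 0
  · have : Subsingleton (LinearMap.ker (locCohMap (maximalIdeal R) xs.length f)) := by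
      rw [hl, LinearMap.ker_eq_bot.2 (locCohMap_zero_injective hf)]
      infer_instance
    exact koszulMult_eq_zero_of_subsingleton
  · obtain ⟨j, hj⟩ : ∃ j, xs.length = j + 1 := ⟨xs.length - 1, by lia⟩
    rw [hj]
    obtain ⟨δ, -, e3⟩ := exists_locCoh_connecting (I := maximalIdeal R) (i := j) hf hg hfg
    rw [LinearMap.exact_iff.1 e3]
    exact koszulMult_range_eq_zero (h''.locCoh j) δ
      (koszulMult_locCoh_eq_zero_of_lt_length hxs h'' (by lia))

lemma IsParamList.supportDim_le [Module.Finite R M] (hxs : ∀ x ∈ xs, x ∈ maximalIdeal R)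
    (h : IsParamList xs M) :
    supportDim R M ≤ xs.length := by
  induction xs generalizing M with
  | nil =>
    rw [supportDim_eq_ringKrullDim_quotient_annihilator]
    have := h.isArtinianRing_quotient
    exact Ring.krullDimLE_iff.1 (inferInstance : Ring.KrullDimLE 0 _)
  | cons x xs ih =>
    refine (supportDim_le_supportDim_quotSMulTop_succ (hxs x List.mem_cons_self)).trans ?_
    rw [List.length_cons]
    push_cast
    gcongr
    exact ih (fun y hy ↦ hxs y (List.mem_cons_of_mem _ hy)) h.quotSMulTop

/-- The multiplicity of top local cohomology is positive. -/
theorem koszulMult_locCoh_pos [Module.Finite R M] (hxs : ∀ x ∈ xs, x ∈ maximalIdeal R)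
    (h : IsParamList xs M) (hd : xs.length ≤ supportDim R M) :
    0 < koszulMult xs (LocCoh (maximalIdeal R) xs.length M) := by
  induction xs generalizing M with
  | nil =>
    obtain ⟨n, hn⟩ := h.exists_pow_smul_eq_zero
    obtain ⟨e⟩ := nonempty_locCoh_zero_equiv hn
    have : IsArtinian R (LocCoh (maximalIdeal R) 0 M) := isArtinian_locCoh hxs h 0
    have hA := (h.locCoh 0).length_ne_top
    have hM : Nontrivial M := by
      rw [← supportDim_ne_bot_iff_nontrivial R]
      rintro h0
      simp [h0] at hd
    have := e.toEquiv.nontrivial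
    rw [List.length_nil, koszulMult_nil, Int.natCast_pos, Nat.pos_iff_ne_zero, Ne,
      ENat.toNat_eq_zero, not_or]
    exact ⟨fun h0 ↦ not_subsingleton _ (Module.length_eq_zero_iff.1 h0), hA⟩
  | cons x xs ih =>
    have hxs' : ∀ x ∈ xs, x ∈ maximalIdeal R := fun y hy ↦ hxs y (List.mem_cons_of_mem _ hy)
    have hx : x ∈ maximalIdeal R := hxs x List.mem_cons_self
    obtain ⟨n, hn⟩ := exists_isSMulRegular_quotient_torsionBy x M
    set U := torsionBy R M (x ^ n)
    have hU := h.of_injective _ (subtype_injective U)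
    have hN := h.of_surjective _ (mkQ_surjective U)
    have hA' := isArtinian_locCoh hxs hU (xs.length + 1)
    have hA'' (i : ℕ) := isArtinian_locCoh hxs hN i
    rw [koszulMult_locCoh_add hxs h (subtype_injective U) (mkQ_surjective U)
      (LinearMap.exact_subtype_mkQ U), List.length_cons]
    have h1 := koszulMult_nonneg (hU.locCoh (xs.length + 1))
    suffices 0 < koszulMult (x :: xs) (LocCoh (maximalIdeal R) (xs.length + 1) (M ⧸ U)) by lia
    -- The module `U` has the shorter parameter list `xs`, so its dimension is too small and the
    -- full dimension survives in `M/U`.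
    have hdim := (le_supportDim_or_of_exact (subtype_injective U) (mkQ_surjective U)
      (LinearMap.exact_subtype_mkQ U) hd).resolve_left fun hc ↦ by
        have := hc.trans ((hU.tail_of_pow (n := n) fun z ↦ smul_torsionBy _ z).supportDim_le hxs')
        rw [List.length_cons] at this
        norm_cast at this
        lia
    have hdim' : xs.length ≤ supportDim R (QuotSMulTop x (M ⧸ U)) := by
      have := hdim.trans (supportDim_le_supportDim_quotSMulTop_succ hx)
      rw [List.length_cons] at this
      push_cast at this
      exact (WithBot.add_le_add_iff_right' (c := 1) (by decide) (by decide)).1 this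
    have hpos := ih hxs' hN.quotSMulTop hdim'
    have hQ := isArtinian_locCoh hxs' hN.quotSMulTop xs.length
    obtain ⟨φ, ψ, hφ, hψ, hφψ⟩ := exists_locCoh_quotSMulTop_exact (maximalIdeal R) hn xs.length
    rw [koszulMult_add (hN.quotSMulTop.locCoh xs.length) φ ψ hφ hψ hφψ] at hpos
    -- With `N = M/U` and `d = xs.length + 1`: `H^(d-1)(N)/x` has multiplicity zero, so `H^d(N)[x]`
    -- inherits the positive multiplicity of `H^(d-1)(N/xN)`.
    have hz := koszulMult_locCoh_eq_zero_of_lt_length hxs hN (i := xs.length) (by simp)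
    rw [koszulMult_cons, koszulMult_torsionBy_locCoh_eq_zero hxs' hN hn xs.length fun j hj ↦
      koszulMult_locCoh_eq_zero_of_lt_length hxs' hN.quotSMulTop (by lia)] at hz
    -- Since `H^d(N/xN) = 0`, multiplication by `x` is surjective on `H^d(N)` and the quotient term
    -- drops out.
    have hV := subsingleton_locCoh_of_length_lt hxs' hN.quotSMulTop (Nat.lt_succ_self _)
    obtain ⟨φ', -, hφ', -, -⟩ :=
      exists_locCoh_quotSMulTop_exact (maximalIdeal R) hn (xs.length + 1)
    have := hφ'.subsingleton
    rw [koszulMult_cons, koszulMult_eq_zero_of_subsingleton (H := QuotSMulTop x _)]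
    lia

end LocalCohomologyMultiplicity

/-! ### Grothendieck vanishing and the annihilator of top local cohomology. -/

section TopLocalCohomology

open Module Submodule IsLocalRing
open scoped Pointwise

variable {R : Type u} [CommRing R] {M : Type u} [AddCommGroup M] [Module R M]

lemma locCohMap_surjective {I : Ideal R} {i : ℕ} {M' M'' : Type u} [AddCommGroup M'] [Module R M']
    [AddCommGroup M''] [Module R M''] {f : M' →ₗ[R] M} {g : M →ₗ[R] M''}
    (hf : Function.Injective f) (hg : Function.Surjective g) (hfg : Function.Exact f g)
    (h : Subsingleton (LocCoh I (i + 1) M')) : Function.Surjective (locCohMap I i g) := by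
  obtain ⟨δ, h1, -⟩ := exists_locCoh_connecting (I := I) (i := i) hf hg hfg
  exact fun z ↦ (h1 z).1 (Subsingleton.elim _ _)

variable [IsLocalRing R]

lemma subsingleton_locCoh_of_subsingleton [Subsingleton M] (i : ℕ) :
    Subsingleton (LocCoh (maximalIdeal R) i M) := by
  refine (Module.annihilator_eq_top_iff (R := R)).1 (eq_top_iff.2 ?_)
  refine le_trans ?_ annihilator_le_annihilator_locCoh
  rw [Module.annihilator_eq_top_iff.2 inferInstance]

lemma isParamList_of_subsingleton [Subsingleton M] (xs : List R) : IsParamList xs M := by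
  rw [IsParamList, annihilator_eq_top_iff.2 inferInstance, top_sup_eq, Ideal.radical_top]
  exact le_top

variable [IsNoetherianRing R]

theorem exists_isParamList [Module.Finite R M] {d : ℕ} (hd : supportDim R M ≤ d) :
    ∃ xs : List R, xs.length = d ∧ (∀ x ∈ xs, x ∈ maximalIdeal R) ∧ IsParamList xs M := by
  cases subsingleton_or_nontrivial M with
  | inl h =>
    refine ⟨List.replicate d 0, List.length_replicate, fun x hx ↦ ?_, isParamList_of_subsingleton _⟩
    rw [List.eq_of_mem_replicate hx]
    exact zero_mem _
  | inr h =>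
    have hne : annihilator R M ≠ ⊤ := fun h0 ↦
      not_subsingleton M (annihilator_eq_top_iff.1 h0)
    have : Nontrivial (R ⧸ annihilator R M) := Ideal.Quotient.nontrivial_iff.2 hne
    have hsurj := Ideal.Quotient.mk_surjective (I := annihilator R M)
    have : IsLocalRing (R ⧸ annihilator R M) := .of_surjective' _ hsurj
    -- The maximal ideal of `R / Ann M` is minimal over an ideal with as many generators as its
    -- height. Lifts of these, padded with zeros to length `d`, form the list.
    obtain ⟨s, hs, hcard⟩ :=
      (maximalIdeal (R ⧸ annihilator R M)).exists_finset_card_eq_height_of_isNoetherianRing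
    rw [supportDim_eq_ringKrullDim_quotient_annihilator,
      ← IsLocalRing.maximalIdeal_height_eq_ringKrullDim, ← hcard] at hd
    norm_cast at hd
    have hmem (y : R) (hy : Ideal.Quotient.mk (annihilator R M) y ∈ maximalIdeal _) :
        y ∈ maximalIdeal R := by
      by_contra hc
      exact (mem_maximalIdeal _).1 hy ((notMem_maximalIdeal.1 hc).map _)
    refine ⟨s.toList.map (Function.surjInv hsurj) ++ List.replicate (d - s.card) 0, ?_, ?_, ?_⟩
    · simp
      lia
    · intro x hx
      rcases List.mem_append.1 hx with hx | hx
      · obtain ⟨y, hy, rfl⟩ := List.mem_map.1 hx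
        refine hmem _ ?_
        rw [Function.surjInv_eq hsurj]
        exact hs.1.2 (Ideal.subset_span (Finset.mem_toList.1 hy))
      · rw [List.eq_of_mem_replicate hx]
        exact zero_mem _
    · rw [IsParamList, Ideal.radical_eq_sInf]
      refine le_sInf fun P ⟨hP, hPp⟩ ↦ ?_
      have hker : RingHom.ker (Ideal.Quotient.mk (annihilator R M)) ≤ P := by
        rw [Ideal.mk_ker]
        exact le_sup_left.trans hP
      have hP' := Ideal.map_isPrime_of_surjective hsurj hker
      have hle : Ideal.span s ≤ P.map (Ideal.Quotient.mk (annihilator R M)) := by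
        refine Ideal.span_le.2 fun y hy ↦ ?_
        rw [← Function.surjInv_eq hsurj y]
        refine Ideal.mem_map_of_mem _ (hP (Ideal.mem_sup_right (Ideal.subset_span ?_)))
        exact List.mem_append_left _ (List.mem_map_of_mem (Finset.mem_toList.2 hy))
      have h1 := hs.2 ⟨hP', hle⟩ (le_maximalIdeal hP'.ne_top)
      intro y hy
      have h2 : Ideal.Quotient.mk (annihilator R M) y ∈ maximalIdeal _ := by
        have hloc : IsLocalHom (Ideal.Quotient.mk (annihilator R M)) :=
          .of_surjective _ hsurj
        exact (mem_maximalIdeal _).2 fun hu ↦ (mem_maximalIdeal _).1 hy (isUnit_of_map_unit _ _ hu)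
      have h3 := h1 h2
      rw [← Ideal.mem_comap, Ideal.comap_map_of_surjective' _ hsurj, sup_eq_left.2 hker] at h3
      exact h3

/-- Grothendieck's vanishing theorem for finite modules over Noetherian local rings. -/
theorem subsingleton_locCoh_of_supportDim_lt [Module.Finite R M] {i : ℕ}
    (hi : supportDim R M < i) : Subsingleton (LocCoh (maximalIdeal R) i M) := by
  cases subsingleton_or_nontrivial M with
  | inl h => exact subsingleton_locCoh_of_subsingleton i
  | inr h =>
    obtain ⟨e, he⟩ : ∃ e : ℕ, supportDim R M = e := by
      obtain ⟨a, ha⟩ := WithBot.ne_bot_iff_exists.1 (supportDim_ne_bot_of_nontrivial R M)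
      rw [← ha] at hi
      obtain ⟨e, rfl⟩ := ENat.ne_top_iff_exists.1 (WithBot.coe_lt_coe.1 hi).ne_top
      exact ⟨e, ha.symm⟩
    obtain ⟨xs, hl, hxs, h1⟩ := exists_isParamList he.le
    rw [he] at hi
    norm_cast at hi
    exact subsingleton_locCoh_of_length_lt hxs h1 (by lia)

/-- Here `N` plays the role of `rM`. As `H^d(M) → H^d(N)` is onto and its composite with `H^d(N) →
H^d(M)` is `r = 0`, the latter map is zero and `H^d(M) ≅ H^d(M/rM)`. Additivity leaves multiplicity
zero for `H^d(N)`, which is impossible in dimension `d`. -/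
lemma supportDim_lt_of_smul_locCoh_eq_zero [Module.Finite R M] {d : ℕ} (hd : supportDim R M ≤ d)
    {r : R} (hr : ∀ z : LocCoh (maximalIdeal R) d M, r • z = 0) {N : Type u} [AddCommGroup N]
    [Module R N] {f : N →ₗ[R] M} {g : M →ₗ[R] N} (hf : Function.Injective f)
    (hg : Function.Surjective g) (hfg : f ∘ₗ g = r • LinearMap.id) : supportDim R N < d := by
  obtain ⟨xs, rfl, hxs, h⟩ := exists_isParamList hd
  by_contra! hc
  have hN : Module.Finite R N := Module.Finite.of_surjective g hg
  have hP := h.of_injective f hf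
  have hC : Function.Exact f (LinearMap.range f).mkQ := by rw [LinearMap.exact_iff, ker_mkQ]
  have hpos := koszulMult_locCoh_pos hxs hP hc
  have hadd := koszulMult_locCoh_add hxs h hf (mkQ_surjective _) hC
  have hgs : Function.Surjective (locCohMap (maximalIdeal R) xs.length g) :=
    locCohMap_surjective (subtype_injective (LinearMap.ker g)) hg (LinearMap.exact_subtype_ker_map g)
      (subsingleton_locCoh_of_length_lt hxs (h.of_injective _ (subtype_injective _))
        (Nat.lt_succ_self _))
  have hf0 (z) : locCohMap (maximalIdeal R) xs.length f z = 0 := by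
    obtain ⟨z, rfl⟩ := hgs z
    rw [← locCohMap_comp, hfg]
    exact (locCohMap_smul_id r z).trans (hr z)
  have e1 := locCohMap_exact (I := maximalIdeal R) (i := xs.length) hf (mkQ_surjective _) hC
  have hπ : Function.Bijective (locCohMap (maximalIdeal R) xs.length (LinearMap.range f).mkQ) := by
    refine ⟨(injective_iff_map_eq_zero _).2 fun z hz ↦ ?_, locCohMap_surjective hf
      (mkQ_surjective _) hC (subsingleton_locCoh_of_length_lt hxs hP (Nat.lt_succ_self _))⟩
    obtain ⟨y, rfl⟩ := (e1 z).1 hz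
    exact hf0 y
  have := isArtinian_locCoh hxs h xs.length
  have := koszulMult_congr (h.locCoh xs.length) (LinearEquiv.ofBijective _ hπ)
  lia

/-- The annihilator of the local cohomology of `M` in degree `d ≥ dim M` consists of the elements
`r` with `dim rM < d`. -/
theorem mem_annihilator_locCoh_iff [Module.Finite R M] {d : ℕ} (hd : supportDim R M ≤ d) (r : R) :
    r ∈ annihilator R (LocCoh (maximalIdeal R) d M) ↔
      supportDim R (LinearMap.range (LinearMap.lsmul R M r)) < d := by
  have key {N : Type u} [AddCommGroup N] [Module R N] (f : N →ₗ[R] M) (g : M →ₗ[R] N)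
      (hf : Function.Injective f) (hg : Function.Surjective g) (hfg : f ∘ₗ g = r • LinearMap.id) :
      r ∈ annihilator R (LocCoh (maximalIdeal R) d M) ↔ supportDim R N < d := by
    have hN : Module.Finite R N := Module.Finite.of_surjective g hg
    refine ⟨fun hr ↦ supportDim_lt_of_smul_locCoh_eq_zero hd
      (fun z ↦ Module.mem_annihilator.1 hr z) hf hg hfg, fun hr ↦ Module.mem_annihilator.2 fun z ↦ ?_⟩
    have := subsingleton_locCoh_of_supportDim_lt hr
    have h1 := locCohMap_comp (I := maximalIdeal R) (i := d) f g z
    rw [Subsingleton.elim (locCohMap (maximalIdeal R) d g z) 0, map_zero, hfg] at h1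
    exact (locCohMap_smul_id r z).symm.trans h1
  exact key (LinearMap.range (LinearMap.lsmul R M r)).subtype
    (LinearMap.lsmul R M r).rangeRestrict (subtype_injective _)
    (LinearMap.surjective_rangeRestrict _) rfl

end TopLocalCohomology

/-! ### Catenarity as a dimension inequality, `coheight p` being `dim R/p`. -/

section ChainsOfPrimes

open Order

lemma LTSeries.add_le_coheight {α : Type*} [PartialOrder α] (s : LTSeries α) {a b : α}
    (ha : a ≤ s.head) (hb : s.last ≤ b) {n : ℕ} (hn : n ≤ coheight b) :
    ((s.length + n : ℕ) : ℕ∞) ≤ coheight a := by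
  obtain ⟨t, ht, rfl⟩ := exists_series_of_le_coheight s.last (hn.trans (coheight_anti hb))
  have h := length_le_coheight (x := a) (p := RelSeries.smash s t ht.symm)
    (by rw [RelSeries.head_smash]; exact ha)
  exact h

lemma exists_relSeries_covBy_of_le {α : Type*} [PartialOrder α] [WellFoundedLT α]
    [WellFoundedGT α] {a b : α} (h : a ≤ b) :
    ∃ s : RelSeries {(x, y) : α × α | x ⋖ y}, s.head = a ∧ s.last = b := by
  obtain ⟨f, hf, n, hn, hc⟩ := exists_covBy_seq_of_wellFoundedLT_wellFoundedGT_of_le h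
  exact ⟨⟨n, fun i ↦ f i, fun i ↦ hc i i.2⟩, hf, hn⟩

/-- A saturated chain as a chain. -/
def RelSeries.ofCovBy {α : Type*} [PartialOrder α] (s : RelSeries {(x, y) : α × α | x ⋖ y}) :
    LTSeries α :=
  ⟨s.length, s, fun i ↦ (s.step i).lt⟩

variable {R : Type u} [CommRing R] [IsLocalRing R] [IsNoetherianRing R]

/-- In a catenary Noetherian local ring, `dim R/q ≤ ht p/q + dim R/p`. -/
lemma IsCatenaryRing.exists_coheight_le (hR : IsCatenaryRing R) {q p : PrimeSpectrum R}
    (h : q ≤ p) :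
    ∃ s : LTSeries (PrimeSpectrum R), s.head = q ∧ s.last = p ∧
      coheight q ≤ s.length + coheight p := by
  have hle (x : PrimeSpectrum R) : x ≤ IsLocalRing.closedPoint R :=
    IsLocalRing.le_maximalIdeal x.2.ne_top
  have : WellFoundedLT (PrimeSpectrum R) :=
    ⟨SetRel.IsWellFounded.of_finiteDimensional {(a, b) : PrimeSpectrum R × PrimeSpectrum R | a < b}⟩
  have : WellFoundedGT (PrimeSpectrum R) :=
    ⟨SetRel.IsWellFounded.inv_of_finiteDimensional
      {(a, b) : PrimeSpectrum R × PrimeSpectrum R | a < b}⟩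
  obtain ⟨s, hs, hs'⟩ := exists_relSeries_covBy_of_le h
  obtain ⟨t, ht, ht'⟩ := exists_relSeries_covBy_of_le (hle p)
  obtain ⟨n, hn, hn'⟩ := hR q (IsLocalRing.closedPoint R) (hle q)
  refine ⟨s.ofCovBy, hs, hs', ?_⟩
  -- Joining saturated chains from `q` to `p` and from `p` to the closed point gives length `n`,
  -- which also bounds every chain starting at `q`, after extension to the closed point.
  have h1 : s.length + t.length = n :=
    hn' (s.smash t (hs'.trans ht.symm)) ((RelSeries.head_smash _).trans hs)
      ((RelSeries.last_smash _).trans ht')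
  have h2 : (t.length : ℕ∞) ≤ coheight p := length_le_coheight (p := t.ofCovBy) ht.ge
  have h3 : coheight q ≤ n := by
    refine coheight_le fun r hr ↦ ?_
    norm_cast
    rcases (hle r.last).lt_or_eq with hlt | heq
    · have := hn (r.snoc _ hlt) ((RelSeries.head_snoc _ _ _).trans hr) (RelSeries.last_snoc _ _ _)
      rw [RelSeries.snoc_length] at this
      lia
    · exact hn r hr heq
  calc coheight q ≤ n := h3
    _ = s.length + t.length := by rw [← h1]; push_cast; rfl
    _ ≤ s.length + coheight p := by gcongr

/-- A Noetherian local ring with `dim R/q ≤ ht p/q + dim R/p` for all `q ≤ p` is catenary. -/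
lemma isCatenaryRing_of_exists_coheight_le
    (hR : ∀ q p : PrimeSpectrum R, q ≤ p → ∃ s : LTSeries (PrimeSpectrum R),
      q ≤ s.head ∧ s.last ≤ p ∧ coheight q ≤ s.length + coheight p) : IsCatenaryRing R := by
  intro p q _
  obtain ⟨a, ha⟩ := ENat.ne_top_iff_exists.1 (coheight_lt_top p).ne
  obtain ⟨b, hb⟩ := ENat.ne_top_iff_exists.1 (coheight_lt_top q).ne
  have bound (s : LTSeries (PrimeSpectrum R)) (hs : s.head = p) (hs' : s.last = q) :
      s.length + b ≤ a := by
    have := s.add_le_coheight hs.ge hs'.le hb.le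
    rw [← ha] at this
    exact_mod_cast this
  refine ⟨a - b, fun s hs hs' ↦ ?_, fun s hs hs' ↦ ?_⟩
  · have := bound s hs hs'
    lia
  · refine le_antisymm (by have := bound s.ofCovBy hs hs'; exact Nat.le_sub_of_add_le this) ?_
    -- Along a saturated chain the coheight drops by at most one per step: a chain between a prime
    -- and one covering it has length at most 1.
    have key : ∀ i : ℕ, ∀ hi : i < s.length + 1, coheight s.head ≤ i + coheight (s ⟨i, hi⟩) := by
      intro i
      induction i with
      | zero => intro hi; exact le_of_eq (by rw [Nat.cast_zero, zero_add]; rfl)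
      | succ i ih =>
        intro hi
        refine (ih (by lia)).trans ?_
        have hc : s ⟨i, by lia⟩ ⋖ s ⟨i + 1, hi⟩ := s.step ⟨i, by lia⟩
        obtain ⟨r, hr, hr', hle⟩ := hR _ _ hc.le
        have hr1 : r.length ≤ 1 := by
          by_contra! h2
          have h3 : r.head < r ⟨1, by lia⟩ := r.strictMono (Fin.mk_lt_mk.2 Nat.zero_lt_one)
          have h4 : r ⟨1, by lia⟩ < r.last := r.strictMono (Fin.mk_lt_mk.2 h2)
          exact hc.2 (hr.trans_lt h3) (h4.trans_le hr')
        have hr2 : (r.length : ℕ∞) ≤ 1 := by exact_mod_cast hr1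
        calc i + coheight (s ⟨i, by lia⟩) ≤ i + (r.length + coheight (s ⟨i + 1, hi⟩)) := by gcongr
          _ ≤ i + (1 + coheight (s ⟨i + 1, hi⟩)) := by gcongr
          _ = (i + 1 : ℕ) + coheight (s ⟨i + 1, hi⟩) := by push_cast; rw [add_assoc]
    have h1 : coheight s.head ≤ s.length + coheight s.last := key s.length (by lia)
    rw [hs, hs', ← ha, ← hb] at h1
    have : a ≤ s.length + b := by exact_mod_cast h1
    lia

end ChainsOfPrimes

/-! ### Dimension of supports and of the multiples `uM`. -/

section SupportDimension

open Order Module Submodule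

variable {R : Type u} [CommRing R] {M : Type u} [AddCommGroup M] [Module R M]

lemma natCast_le_supportDim_iff {d : ℕ} :
    d ≤ supportDim R M ↔ ∃ q ∈ support R M, d ≤ coheight q := by
  rw [supportDim, le_krullDim_iff]
  constructor
  · rintro ⟨s, rfl⟩
    exact ⟨s.head, s.head.2, length_le_coheight (p := s.map Subtype.val fun _ _ h ↦ h) le_rfl⟩
  · rintro ⟨q, hq, hd⟩
    obtain ⟨s, rfl, rfl⟩ := exists_series_of_le_coheight q hd
    exact ⟨⟨s.length, fun i ↦ ⟨s i, mem_support_mono (s.head_le i) hq⟩, fun i ↦ s.step i⟩, rfl⟩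

lemma supportDim_quotient_asIdeal (p : PrimeSpectrum R) :
    supportDim R (R ⧸ p.asIdeal) = coheight p := by
  rw [coheight_eq_krullDim_Ici, supportDim_quotient_eq_ringKrullDim, ringKrullDim_quotient]
  rfl

lemma mem_support_range_lsmul_iff {q : PrimeSpectrum R} {a : R} :
    q ∈ support R (LinearMap.range (LinearMap.lsmul R M a)) ↔
      ∃ m : M, ∀ b, b • a • m = 0 → b ∈ q.asIdeal := by
  rw [mem_support_iff']
  constructor
  · rintro ⟨⟨_, m, rfl⟩, h⟩
    exact ⟨m, fun b hb ↦ not_imp_comm.1 (h b) (not_not.2 (Subtype.ext hb))⟩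
  · rintro ⟨m, h⟩
    exact ⟨⟨_, m, rfl⟩, fun b hb h0 ↦ hb (h b (congrArg Subtype.val h0))⟩

/-- If no prime `q ≤ p` in the support of `M` has `dim R/q ≥ d`, then some `u ∉ p` has
`dim uM < d`. -/
lemma exists_supportDim_range_lsmul_lt [IsNoetherianRing R] [Module.Finite R M]
    (p : PrimeSpectrum R) (d : ℕ)
    (hp : ∀ q ∈ support R M, q ≤ p → ¬ (d ≤ coheight q)) :
    ∃ u ∉ p.asIdeal, supportDim R (LinearMap.range (LinearMap.lsmul R M u)) < d := by
  -- `T` consists of the elements vanishing in `M_q` for every `q` with `dim R/q ≥ d`. Any `u` with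
  -- `uM ⊆ T` has `dim uM < d`, so a `u ∉ p` annihilating `M/T` is wanted.
  let T : Submodule R M := ⨅ q : {q : PrimeSpectrum R // d ≤ coheight q},
    LinearMap.ker (LocalizedModule.mkLinearMap q.1.asIdeal.primeCompl M)
  have hT (m : M) : m ∈ T ↔ ∀ q : PrimeSpectrum R, d ≤ coheight q → ∃ b ∉ q.asIdeal, b • m = 0 := by
    simp only [T, mem_iInf, Subtype.forall, LocalizedModule.mem_ker_mkLinearMap_iff]
    rfl
  suffices h : ¬ annihilator R (M ⧸ T) ≤ p.asIdeal by
    obtain ⟨u, hu, hup⟩ := SetLike.not_le_iff_exists.1 h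
    refine ⟨u, hup, ?_⟩
    by_contra! hc
    obtain ⟨q, hq, hd⟩ := natCast_le_supportDim_iff.1 hc
    obtain ⟨m, hm⟩ := mem_support_range_lsmul_iff.1 hq
    have h1 : u • m ∈ T := (Submodule.Quotient.mk_eq_zero T).1
      (Module.mem_annihilator.1 hu (Submodule.Quotient.mk m))
    obtain ⟨b, hb, hbm⟩ := (hT _).1 h1 q hd
    exact hb (hm b hbm)
  intro hle
  -- Otherwise some associated prime `q` of `M/T` lies in `p`, say the annihilator of the class of
  -- `n`. As `n ∉ T`, it survives at some `q'` with `dim R/q' ≥ d`; then `q ⊆ q'`, so `dim R/q ≥ d`,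
  -- against `hp`.
  obtain ⟨q, hq, hqp⟩ := Ideal.exists_minimalPrimes_le hle
  obtain ⟨hqp', x, hx⟩ := isAssociatedPrime_iff.1
    (associatedPrimes.minimalPrimes_annihilator_subset_associatedPrimes R (M ⧸ T) hq)
  obtain ⟨n, rfl⟩ := Submodule.Quotient.mk_surjective _ x
  have hqn (r : R) : r ∈ q ↔ r • n ∈ T := by
    rw [hx, mem_colon_singleton, mem_bot, ← Submodule.Quotient.mk_smul,
      Submodule.Quotient.mk_eq_zero]
  refine hp ⟨q, hqp'⟩ ?_ hqp ?_
  · rw [mem_support_iff_of_finite]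
    exact fun r hr ↦ (hqn r).2 (by rw [Module.mem_annihilator.1 hr]; exact T.zero_mem)
  · have hn : n ∉ T := fun h ↦ hqp'.ne_top
      ((Ideal.eq_top_iff_one _).2 ((hqn 1).2 (by rwa [one_smul])))
    rw [hT] at hn
    push Not at hn
    obtain ⟨q', hd, hq'⟩ := hn
    refine hd.trans (coheight_anti ?_)
    intro r hr
    by_contra hc
    obtain ⟨b, hb, hbr⟩ := (hT _).1 ((hqn r).1 hr) q' hd
    refine hq' (b * r) (fun h ↦ (q'.2.mem_or_mem h).elim hb hc) ?_
    rw [mul_smul, hbr]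

end SupportDimension

/-! ### Supports over the localization at a prime. -/

section LocalizedSupport

open Order Module Submodule

variable {R : Type u} [CommRing R] {M : Type u} [AddCommGroup M] [Module R M] (p : Ideal R)
  [p.IsPrime]

lemma mem_support_range_lsmul_mk'_iff (q : PrimeSpectrum (Localization.AtPrime p)) (a : R)
    (s : p.primeCompl) :
    q ∈ support (Localization.AtPrime p) (LinearMap.range (LinearMap.lsmul (Localization.AtPrime p)
        (LocalizedModule p.primeCompl M) (IsLocalization.mk' _ a s))) ↔
      q.comap (algebraMap R _) ∈ support R (LinearMap.range (LinearMap.lsmul R M a)) := by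
  have hu (u : p.primeCompl) (b : R) (h : (u : R) * b ∈ (q.comap (algebraMap R _)).asIdeal) :
      b ∈ (q.comap (algebraMap R _)).asIdeal := by
    refine ((q.comap (algebraMap R _)).2.mem_or_mem h).resolve_left fun hc ↦ ?_
    exact q.2.ne_top (Ideal.eq_top_of_isUnit_mem _ hc (IsLocalization.map_units _ u))
  have key (b a : R) (t s v : p.primeCompl) (m : M) :
      IsLocalization.mk' (Localization.AtPrime p) b t •
        IsLocalization.mk' (Localization.AtPrime p) a s •
        LocalizedModule.mk m v = 0 ↔ ∃ u : p.primeCompl, ((u : R) * b) • a • m = 0 := by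
    rw [← Localization.mk_eq_mk', LocalizedModule.mk_smul_mk,
      LocalizedModule.mk_smul_mk, ← LocalizedModule.zero_mk (1 : p.primeCompl), LocalizedModule.mk_eq]
    refine exists_congr fun u ↦ ?_
    simp only [Submonoid.smul_def, smul_zero, one_smul, mul_smul]
  rw [mem_support_range_lsmul_iff, mem_support_range_lsmul_iff]
  constructor
  · rintro ⟨z, hz⟩
    induction z with | h m v => 
    refine ⟨m, fun b hb ↦ ?_⟩
    have := hz (IsLocalization.mk' _ b (1 : p.primeCompl))
      ((key b a 1 s v m).2 ⟨1, by rw [OneMemClass.coe_one, one_mul]; exact hb⟩)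
    rwa [IsLocalization.mk'_one] at this
  · rintro ⟨m, hm⟩
    refine ⟨LocalizedModule.mk m 1, fun z hz ↦ ?_⟩
    obtain ⟨b, t, rfl⟩ := IsLocalization.exists_mk'_eq p.primeCompl z
    obtain ⟨u, hu'⟩ := (key b a t s 1 m).1 hz
    have := hu u b (hm _ hu')
    rw [IsLocalization.mk'_mem_iff]
    exact this

lemma support_range_lsmul_one : support R (LinearMap.range (LinearMap.lsmul R M 1)) = support R M :=
  (LinearEquiv.ofTop _ (LinearMap.range_eq_top.2 fun m ↦ ⟨m, one_smul R m⟩)).support_eq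

lemma mem_support_localizedModule_iff (q : PrimeSpectrum (Localization.AtPrime p)) :
    q ∈ support (Localization.AtPrime p) (LocalizedModule p.primeCompl M) ↔
      q.comap (algebraMap R _) ∈ support R M := by
  have h := mem_support_range_lsmul_mk'_iff (M := M) p q 1 1
  rwa [IsLocalization.mk'_one, map_one, support_range_lsmul_one, support_range_lsmul_one] at h

/-- Primes of `R_p` are primes inside `p`, and upward closure of `S` means only the first member of
a chain needs testing. The set `S` is general so that both `M_p` and its multiples `(a/s) M_p` are
covered. -/
lemma natCast_le_supportDim_localization_iff {N : Type u} [AddCommGroup N]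
    [Module (Localization.AtPrime p) N] {S : Set (PrimeSpectrum R)} (hS : IsUpperSet S)
    (h : ∀ q, q ∈ support (Localization.AtPrime p) N ↔ q.comap (algebraMap R _) ∈ S) {i : ℕ} :
    i ≤ supportDim (Localization.AtPrime p) N ↔
      ∃ s : LTSeries (PrimeSpectrum R), s.head ∈ S ∧ s.last.asIdeal ≤ p ∧ s.length = i := by
  let e := IsLocalization.AtPrime.primeSpectrumOrderIso (Localization.AtPrime p) p
  have he (q) : (e q).1 = q.comap (algebraMap R _) := rfl
  rw [supportDim, le_krullDim_iff]
  constructor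
  · rintro ⟨s, rfl⟩
    refine ⟨s.map (fun q ↦ (e q.1).1) fun _ _ hlt ↦ e.strictMono hlt, ?_, ?_, rfl⟩
    · exact (h _).1 s.head.2
    · exact (e s.last.1).2
  · rintro ⟨s, hs, hl, rfl⟩
    have hsp (j) : s j ≤ ⟨p, inferInstance⟩ := (s.monotone (Fin.le_last j)).trans hl
    refine ⟨⟨s.length, fun j ↦ ⟨e.symm ⟨s j, hsp j⟩, (h _).2 ?_⟩, fun j ↦ ?_⟩, rfl⟩
    · rw [← he, e.apply_symm_apply]
      exact hS (s.head_le j) hs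
    · exact e.symm.strictMono (s.step j)

end LocalizedSupport

/-! ### The two directions of the criterion. -/

section CatenaryCriterion

open Order Module Submodule IsLocalRing

variable {R : Type u} [CommRing R]

lemma isUpperSet_support (M : Type u) [AddCommGroup M] [Module R M] : IsUpperSet (support R M) :=
  fun _ _ h hp ↦ mem_support_mono h hp

lemma annihilator_localCohomologyInt_natCast (I : Ideal R) (n : ℕ) (M : Type u) [AddCommGroup M]
    [Module R M] : annihilator R (localCohomologyInt I n M) = annihilator R (LocCoh I n M) := rfl

lemma annihilator_localCohomologyInt_of_neg (I : Ideal R) {n : ℤ} (hn : n < 0) (M : Type u)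
    [AddCommGroup M] [Module R M] : annihilator R (localCohomologyInt I n M) = ⊤ := by
  obtain ⟨k, rfl⟩ := Int.eq_negSucc_of_lt_zero hn
  exact Module.annihilator_eq_top_iff.2 (inferInstanceAs (Subsingleton PUnit))

lemma moduleDim_quotient_asIdeal {p : PrimeSpectrum R} {n : ℕ} (h : coheight p = n) :
    moduleDim R (R ⧸ p.asIdeal) = n := by
  rw [moduleDim, supportDim_quotient_asIdeal, h]
  rfl

/-- A chain of length `i + 1` in `Supp M` inside `p`, continued by one of length `t` above `p`,
would be too long for `M`. -/
lemma supportDim_localizedModule_le {M : Type u} [AddCommGroup M] [Module R M]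
    {p : PrimeSpectrum R} {t i : ℕ} (ht : coheight p = t)
    (hM : supportDim R M ≤ (t + i : ℕ)) :
    supportDim (Localization.AtPrime p.asIdeal) (LocalizedModule p.asIdeal.primeCompl M) ≤ i := by
  by_contra! hc
  have h1 : ((i + 1 : ℕ) : WithBot ℕ∞) ≤ supportDim (Localization.AtPrime p.asIdeal)
      (LocalizedModule p.asIdeal.primeCompl M) := by
    push_cast
    exact ENat.WithBot.add_one_le_iff.2 hc
  obtain ⟨s, hs, hp, hl⟩ := (natCast_le_supportDim_localization_iff p.asIdeal
    (isUpperSet_support M) (mem_support_localizedModule_iff p.asIdeal)).1 h1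
  have h2 := s.add_le_coheight le_rfl hp ht.ge
  have h3 := (natCast_le_supportDim_iff.2 ⟨_, hs, h2⟩).trans hM
  norm_cast at h3
  lia

variable [IsNoetherianRing R]

lemma exists_series_of_annihilator_locCoh_ne_top {q p : PrimeSpectrum R} {i : ℕ}
    (h : annihilator (Localization.AtPrime p.asIdeal)
        (LocCoh (maximalIdeal (Localization.AtPrime p.asIdeal)) i
          (LocalizedModule p.asIdeal.primeCompl (R ⧸ q.asIdeal))) ≠ ⊤) :
    ∃ s : LTSeries (PrimeSpectrum R), q ≤ s.head ∧ s.last ≤ p ∧ s.length = i := by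
  have h1 : i ≤ supportDim (Localization.AtPrime p.asIdeal)
      (LocalizedModule p.asIdeal.primeCompl (R ⧸ q.asIdeal)) := by
    by_contra! hc
    exact h (Module.annihilator_eq_top_iff.2 (subsingleton_locCoh_of_supportDim_lt hc))
  obtain ⟨s, hs, hp, hl⟩ := (natCast_le_supportDim_localization_iff p.asIdeal
    (isUpperSet_support _) (mem_support_localizedModule_iff p.asIdeal)).1 h1
  refine ⟨s, ?_, hp, hl⟩
  have := annihilator_le_of_mem_support hs
  rwa [Ideal.annihilator_quotient] at this

variable [IsLocalRing R]

lemma exists_coheight_eq (p : PrimeSpectrum R) : ∃ n : ℕ, coheight p = n := by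
  obtain ⟨n, hn⟩ := ENat.ne_top_iff_exists.1 (coheight_lt_top p).ne
  exact ⟨n, hn.symm⟩

lemma exists_supportDim_eq (M : Type u) [AddCommGroup M] [Module R M] [Nontrivial M] :
    ∃ n : ℕ, supportDim R M = n := by
  obtain ⟨a, ha⟩ := WithBot.ne_bot_iff_exists.1 (supportDim_ne_bot_of_nontrivial R M)
  have h := (supportDim_le_ringKrullDim R M).trans_lt ringKrullDim_lt_top
  rw [← ha] at h
  obtain ⟨n, rfl⟩ := ENat.ne_top_iff_exists.1 (WithBot.coe_lt_coe.1 h).ne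
  exact ⟨n, ha.symm⟩

variable {M : Type u} [AddCommGroup M] [Module R M] [Module.Finite R M]

lemma IsCatenaryRing.annihilator_locCoh_localizedModule (hR : IsCatenaryRing R)
    {p : PrimeSpectrum R} {t i : ℕ} (ht : coheight p = t) (hM : supportDim R M ≤ (t + i : ℕ)) :
    annihilator (Localization.AtPrime p.asIdeal)
        (LocCoh (maximalIdeal (Localization.AtPrime p.asIdeal)) i
          (LocalizedModule p.asIdeal.primeCompl M)) =
      (annihilator R (LocCoh (maximalIdeal R) (t + i) M)).map
        (algebraMap R (Localization.AtPrime p.asIdeal)) := by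
  ext y
  obtain ⟨a, v, rfl⟩ := IsLocalization.exists_mk'_eq p.asIdeal.primeCompl y
  rw [IsLocalization.mk'_mem_map_algebraMap_iff,
    mem_annihilator_locCoh_iff (supportDim_localizedModule_le ht hM), ← not_le,
    natCast_le_supportDim_localization_iff p.asIdeal (isUpperSet_support _)
      fun q ↦ mem_support_range_lsmul_mk'_iff p.asIdeal q a v]
  simp only [mem_annihilator_locCoh_iff hM]
  constructor
  · intro h
    obtain ⟨u, hu, hlt⟩ := exists_supportDim_range_lsmul_lt
      (M := LinearMap.range (LinearMap.lsmul R M a)) p (t + i) fun q hq hqp hc ↦ by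
        -- Catenarity enters here: `t + i ≤ dim R/q` forces a chain from `q` to `p` of length at
        -- least `i`; its last `i` steps contradict `h`.
        obtain ⟨s, rfl, hs, hle⟩ := hR.exists_coheight_le hqp
        rw [ht] at hle
        have h1 : i ≤ s.length := by
          have := hc.trans hle
          norm_cast at this
          lia
        refine h ⟨s.drop ⟨s.length - i, by lia⟩, ?_, ?_, ?_⟩
        · exact isUpperSet_support _ ((s.head_le _).trans_eq (RelSeries.head_drop _ _).symm) hq
        · rw [RelSeries.last_drop, hs]
        · simp; lia
    refine ⟨u, hu, ?_⟩
    rw [← not_le, natCast_le_supportDim_iff] at hlt ⊢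
    rintro ⟨q, hq, hd⟩
    refine hlt ⟨q, ?_, hd⟩
    rw [mem_support_range_lsmul_iff] at hq ⊢
    obtain ⟨m, hm⟩ := hq
    refine ⟨⟨a • m, m, rfl⟩, fun b hb ↦ hm b ?_⟩
    rw [mul_smul]
    exact congrArg Subtype.val hb
  -- The head of `s` lies inside `p` and so avoids `u`; it therefore stays in `Supp uaM`, and
  -- prolonging `s` above `p` by a chain of length `t` contradicts `hlt`.
  · rintro ⟨u, hu, hlt⟩ ⟨s, hs, hp, rfl⟩
    refine hlt.not_ge (natCast_le_supportDim_iff.2 ⟨s.head, ?_, ?_⟩)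
    · rw [mem_support_range_lsmul_iff] at hs ⊢
      obtain ⟨m, hm⟩ := hs
      refine ⟨m, fun b hb ↦ ?_⟩
      have h1 : b * u ∈ s.head.asIdeal := hm _ (by rwa [mul_smul, ← mul_smul u])
      exact (s.head.2.mem_or_mem h1).resolve_right fun hc ↦ hu (hp (s.head_le_last hc))
    · rw [add_comm]
      exact s.add_le_coheight le_rfl hp ht.ge

/-- This is the case of negative degree over `R_p`: as `dim M < dim R/p`, no prime of `Supp M` lies
inside `p`. -/
lemma annihilator_locCoh_map_eq_top {p : PrimeSpectrum R} {d : ℕ}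
    (hM : supportDim R M ≤ d) (hd : d < coheight p) :
    (annihilator R (LocCoh (maximalIdeal R) d M)).map
        (algebraMap R (Localization.AtPrime p.asIdeal)) = ⊤ := by
  obtain ⟨u, hu, hlt⟩ := exists_supportDim_range_lsmul_lt (M := M) p d fun q hq hqp _ ↦ by
    have h1 : ((d + 1 : ℕ) : ℕ∞) ≤ coheight p := by
      push_cast
      exact Order.add_one_le_of_lt hd
    have h2 := (natCast_le_supportDim_iff.2 ⟨p, isUpperSet_support M hqp hq, h1⟩).trans hM
    norm_cast at h2
    lia
  refine Ideal.eq_top_of_isUnit_mem _ (Ideal.mem_map_of_mem _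
    ((mem_annihilator_locCoh_iff hM u).2 hlt)) ?_
  exact IsLocalization.map_units (Localization.AtPrime p.asIdeal) (⟨u, hu⟩ : p.asIdeal.primeCompl)

/-- For `r ∉ q` the submodule `r(R/q)` of the domain `R/q` still has `q` in its support, hence
dimension `d`. -/
lemma annihilator_locCoh_quotient_le {q : PrimeSpectrum R} {d : ℕ} (hd : coheight q = d) :
    annihilator R (LocCoh (maximalIdeal R) d (R ⧸ q.asIdeal)) ≤ q.asIdeal := by
  intro r hr
  rw [mem_annihilator_locCoh_iff (by rw [supportDim_quotient_asIdeal, hd]; rfl), ← not_le,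
    natCast_le_supportDim_iff] at hr
  by_contra hrq
  refine hr ⟨q, mem_support_range_lsmul_iff.2 ⟨Ideal.Quotient.mk _ 1, fun b hb ↦ ?_⟩, hd.ge⟩
  have h1 : Ideal.Quotient.mk q.asIdeal (b * (r * 1)) = 0 := hb
  rw [Ideal.Quotient.eq_zero_iff_mem, mul_one] at h1
  exact (q.2.mem_or_mem h1).resolve_right hrq

end CatenaryCriterion

theorem theorem1p1 (R : Type u) [CommRing R] [IsLocalRing R] [IsNoetherianRing R] :
    IsCatenaryRing R ↔
      ∀ (M : Type u) [AddCommGroup M] [Module R M] [Module.Finite R M]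
        (p : Ideal R) [p.IsPrime],
        Module.annihilator (Localization.AtPrime p)
            (localCohomologyInt (IsLocalRing.maximalIdeal (Localization.AtPrime p))
              (moduleDim R M - moduleDim R (R ⧸ p))
              (LocalizedModule p.primeCompl M)) =
          (Module.annihilator R
            (localCohomologyInt (IsLocalRing.maximalIdeal R) (moduleDim R M) M)).map
              (algebraMap R (Localization.AtPrime p)) := by
  constructor
  · intro hR M _ _ _ p hp
    obtain ⟨t, ht⟩ := exists_coheight_eq (⟨p, hp⟩ : PrimeSpectrum R)
    have htp : moduleDim R (R ⧸ p) = t :=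
      moduleDim_quotient_asIdeal (p := ⟨p, hp⟩) ht
    rw [htp]
    cases subsingleton_or_nontrivial M with
    | inl h =>
      have hM : moduleDim R M = -1 := by
        exact congrArg krullDimToInt (Module.supportDim_eq_bot_of_subsingleton R M)
      -- For `M = 0` both degrees are negative, so both annihilators are the unit ideal.
      have h1 : (-1 - t : ℤ) < 0 := by lia
      rw [hM, annihilator_localCohomologyInt_of_neg _ h1,
        annihilator_localCohomologyInt_of_neg _ (by decide), Ideal.map_top]
    | inr h =>
      obtain ⟨d, hd⟩ := exists_supportDim_eq (R := R) M
      have hM : moduleDim R M = d := congrArg krullDimToInt hd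
      rw [hM, annihilator_localCohomologyInt_natCast]
      by_cases htd : t ≤ d
      · obtain ⟨i, rfl⟩ := Nat.exists_eq_add_of_le htd
        rw [show ((t + i : ℕ) : ℤ) - t = (i : ℕ) by push_cast; ring,
          annihilator_localCohomologyInt_natCast]
        exact hR.annihilator_locCoh_localizedModule (p := ⟨p, hp⟩) ht hd.le
      · rw [annihilator_localCohomologyInt_of_neg _ (by lia)]
        exact (annihilator_locCoh_map_eq_top (p := ⟨p, hp⟩) hd.le
          (by rw [ht]; exact_mod_cast not_le.1 htd)).symm
  · intro h
    refine isCatenaryRing_of_exists_coheight_le fun q p hqp ↦ ?_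
    obtain ⟨d, hd⟩ := exists_coheight_eq q
    obtain ⟨t, ht⟩ := exists_coheight_eq p
    have htd : t ≤ d := by
      have := Order.coheight_anti hqp
      rw [hd, ht] at this
      exact_mod_cast this
    obtain ⟨i, rfl⟩ := Nat.exists_eq_add_of_le htd
    -- The right-hand ideal for `R/q` is proper since the annihilator lies in `q ⊆ p`. So the degree
    -- `i = dim R/q - dim R/p` local cohomology over `R_p` is nonzero, and vanishing yields a chain
    -- of length `i` from `q` to `p`.
    have h1 := h (R ⧸ q.asIdeal) p.asIdeal
    rw [moduleDim_quotient_asIdeal hd, moduleDim_quotient_asIdeal ht,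
      show ((t + i : ℕ) : ℤ) - t = (i : ℕ) by push_cast; ring,
      annihilator_localCohomologyInt_natCast, annihilator_localCohomologyInt_natCast] at h1
    obtain ⟨s, hs, hs', hl⟩ := exists_series_of_annihilator_locCoh_ne_top (q := q) (p := p) (i := i)
      (by
        rw [h1, IsLocalization.map_algebraMap_ne_top_iff_disjoint p.asIdeal.primeCompl,
          Set.disjoint_left]
        exact fun r hr hr' ↦ hr (hqp (annihilator_locCoh_quotient_le hd hr')))
    refine ⟨s, hs, hs', ?_⟩
    rw [hd, ht, hl, add_comm]
    push_cast
    rfl
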